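/- Let $1\le m\le n$ and let $M_+(n,m)$ be the open set of real $n\times m$ matrices of rank $m$, with the Riemannian metric $\langle u,v\rangle_a=\operatorname{tr}\big(u(a^Ta)^{-1}v^T\big)\sqrt{\det(a^Ta)}$ for $a\in M_+(n,m)$ and $u,v\in T_aM_+(n,m)=\mathbb R^{n\times m}$. Put $a^+=(a^Ta)^{-1}a^T$, $U=ua^+$, $V=va^+$, $u_0=u-\frac{\operatorname{tr}(U)}{m}a$, $U_0=u_0a^+=U-\frac{\operatorname{tr}(U)}{m}aa^+$, and likewise $v_0,V_0$. Let $R$ be the curvature tensor of the Levi-Civita connection, $R(X,Y)Z=\nabla_X\nabla_YZ-\nabla_Y\nabla_XZ-\nabla_{[X,Y]}Z$, and let $\mathcal K_a(u,v)=\langle R_a(u,v)v,u\rangle_a/\big(\langle u,u\rangle_a\langle v,v\rangle_a-\langle u,v\rangle_a^2\big)$ be the sectional curvature at $a$ of the plane spanned by linearly independent $u,v$. Then for every $a\in M_+(n,m)$ and all $u,v$ that are orthonormal with respect to $\langle\cdot,\cdot\rangle_a$, $$\begin{aligned} \frac{4\mathcal K_a(u,v)}{\sqrt{\det(a^Ta)}}&=\frac{4\langle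 R_a(u,v)v,u\rangle_a}{\sqrt{\det(a^Ta)}}\\ &=2\operatorname{tr}([V_0,U_0][V_0^T,U_0])+2\operatorname{tr}([V_0,U_0^T][V_0,U_0])+2\operatorname{tr}(V_0U_0V_0^TU_0^T)\\ &\quad+\operatorname{tr}(V_0V_0^TU_0^TU_0)-4\operatorname{tr}(V_0V_0U_0^TU_0^T)+4\operatorname{tr}(V_0U_0^TU_0V_0^T)\\ &\quad+\operatorname{tr}(V_0^TV_0U_0U_0^T)-2\operatorname{tr}(V_0V_0^TU_0U_0^T)-2\operatorname{tr}(V_0U_0^TV_0U_0^T)\\ &\quad+6\operatorname{tr}(V_0U_0^TV_0U_0^Taa^+)-3\operatorname{tr}(V_0U_0^TU_0V_0^Taa^+)-3\operatorname{tr}(U_0V_0^TV_0U_0^Taa^+)\\ &\quad-m\operatorname{tr}(V_0V_0^T)\operatorname{tr}(U_0U_0^T)+m\big(\operatorname{tr}(U_0V_0^T)\big)^2 . \end{aligned}$$ Furthermore, for every $a\in M_+(n,m)$: (1) If $u,v$ are linearly independent and one of them is a real multiple of $a$ (a pure trace direction), then $\mathcal K_a(u,v)=0$. (2) Let $m\ge2$.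 If $u,v$ are linearly independent and $U,V$ are symmetric (i.e. $u,v$ are horizontal for the projection $a\mapsto a^Ta$ onto positive definite matrices), then $\mathcal K_a(u,v)\le0$, and $\mathcal K_a(u,v)<0$ if and only if the traceless parts $u_0,v_0$ are linearly independent. Moreover, there are orthonormal $u,v$ with $U,V$ symmetric and $\mathcal K_a(u,v)<0$. (3) If $m=1$, then $\mathcal K_a(u,v)\ge0$ for all linearly independent $u,v$; if moreover $n=2$, then $\mathcal K_a(u,v)=0$ for all linearly independent $u,v$. (4) If $m\in\{2,3\}$ and $n\ge m+2$, then there are orthonormal $u,v$ at $a$ with $\mathcal K_a(u,v)>0$ and orthonormal $u,v$ at $a$ with $\mathcal K_a(u,v)<0$. -/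

import Mathlib

open scoped Matrix

noncomputable section

namespace FullRank

/-! ### Riemannian metrics on open subsets of a vector space (one global chart)

Below, `g x v w` is the value at the point `x` of the metric on the tangent vectors `v`, `w`.
Tangent spaces of an open subset of `E` are identified with `E`. Only the germ of `g` at the
point `a` enters the definitions. -/

/-- The Christoffel map of the Levi-Civita connection of `g` in the global chart: the vector
`Γ_a(u, v)` (unique if `g a` is a positive definite inner product) with
`2 g_a(Γ_a(u, v), w) = (D_u g)(v, w) + (D_v g)(u, w) - (D_w g)(u, v)` for all `w`.
Thus the covariant derivative is `∇_X Y = D_X Y + Γ(X, Y)`. -/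
def christoffel {E : Type*} [AddCommGroup E] [Module ℝ E] [TopologicalSpace E]
    (g : E → E → E → ℝ) (a u v : E) : E :=
  Classical.epsilon fun c : E => ∀ w : E,
    2 * g a c w = fderiv ℝ (fun x => g x v w) a u + fderiv ℝ (fun x => g x u w) a v
      - fderiv ℝ (fun x => g x u v) a w

/-- The Riemann curvature tensor `R_a(u, v) w` of `g`, in the convention
`R(X, Y) Z = ∇_X ∇_Y Z - ∇_Y ∇_X Z - ∇_[X, Y] Z`. -/
def riemannCurvature {E : Type*} [AddCommGroup E] [Module ℝ E] [TopologicalSpace E]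
    (g : E → E → E → ℝ) (a u v w : E) : E :=
  fderiv ℝ (fun x => christoffel g x v w) a u - fderiv ℝ (fun x => christoffel g x u w) a v
    + christoffel g a u (christoffel g a v w) - christoffel g a v (christoffel g a u w)

/-- The sectional curvature at `a` of the plane spanned by linearly independent `u`, `v`. -/
def sectionalCurvature {E : Type*} [AddCommGroup E] [Module ℝ E] [TopologicalSpace E]
    (g : E → E → E → ℝ) (a u v : E) : ℝ :=
  g a (riemannCurvature g a u v v) u / (g a u u * g a v v - g a u v ^ 2)

/-- `u`, `v` are orthonormal with respect to `g` at `a`. -/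
def IsOrthonormalPair {E : Type*} (g : E → E → E → ℝ) (a u v : E) : Prop :=
  g a u u = 1 ∧ g a v v = 1 ∧ g a u v = 0

/-! ### Full rank matrices -/

/-- The space `M_+(n, m)` of real `n × m` matrices of rank `m`, an open subset of the space of all
`n × m` matrices. -/
def MPlus (n m : ℕ) : Set (Matrix (Fin n) (Fin m) ℝ) := {a | a.rank = m}

/-- The Moore-Penrose inverse `a⁺ = (aᵀ a)⁻¹ aᵀ` of a matrix of full column rank. -/
def pinv {n m : ℕ} (a : Matrix (Fin n) (Fin m) ℝ) : Matrix (Fin m) (Fin n) ℝ :=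
  (aᵀ * a)⁻¹ * aᵀ

/-- The Riemannian metric `⟨u, v⟩_a = tr(u (aᵀ a)⁻¹ vᵀ) √det(aᵀ a)` on `M_+(n, m)`. -/
def metric {n m : ℕ} (a u v : Matrix (Fin n) (Fin m) ℝ) : ℝ :=
  (u * (aᵀ * a)⁻¹ * vᵀ).trace * √(aᵀ * a).det

/-- The traceless part `u₀ = u - (tr(u a⁺) / m) a` of a tangent vector `u` at `a`. -/
def tracelessPart {n m : ℕ} (a u : Matrix (Fin n) (Fin m) ℝ) : Matrix (Fin n) (Fin m) ℝ :=
  u - ((u * pinv a).trace / m) • a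

/-- The traceless part `U₀ = U - (tr(U) / m) a a⁺` of the square matrix `U = u a⁺`. -/
def squareTracelessPart {n m : ℕ} (a u : Matrix (Fin n) (Fin m) ℝ) : Matrix (Fin n) (Fin n) ℝ :=
  u * pinv a - ((u * pinv a).trace / m) • (a * pinv a)

/-- The tangent vector `u` at `a` is a pure trace direction, i.e. a real multiple of `a`. -/
def IsPureTrace {n m : ℕ} (a u : Matrix (Fin n) (Fin m) ℝ) : Prop := ∃ c : ℝ, u = c • a

end FullRank

end

/-!
The sectional curvature is computed in the global chart. From the derivatives of `(xᵀ x)⁻¹` and of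
`√det (xᵀ x)` the Koszul formula gives the Christoffel map as the rational expression `chris`, in
which the factor `√det` has cancelled (`christoffel_metric`); differentiating it once more gives the
curvature tensor in closed form (`riemannCurvature_metric`).

Right multiplication by `a⁺` turns these `n × m` expressions into expressions in the square matrices
`U = u a⁺`, `V = v a⁺` and the orthogonal projection `P = a a⁺`, subject only to `U P = U`,
`V P = V` (`curv_mul_pinv`), and the metric becomes `tr (U Vᵀ) √det (aᵀ a)`. The direction `P` of
dilations lies in the kernel of the curvature (`curvSq_add_proj`), since the covariant derivative
of the radial field is a multiple of the identity, and the curvature vector is orthogonal to `P`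
(`trace_curvSq_mul_proj`). So `U`, `V` may be replaced by their traceless parts, for which the
formula is an identity between traces of words, up to rotation and transposition (`trace_curvSq`).

The signs follow from the formula. For a pure trace direction the traceless part vanishes. For
symmetric `U`, `V` the form equals `-7 ‖[U, V]‖²` minus `m` times the Gram determinant
(`curvForm_of_isSymm`), so Cauchy-Schwarz decides. For `m = 1` it is three times the Gram
determinant (`curvForm_one_column`), and for `n = 2` the traceless vectors form a line. Finally
`U = f xᵀ`, `V = g xᵀ`, with `x` a unit vector in the range of `a` and `f`, `g` orthonormal in its
orthogonal complement, gives the value `4 - m`, positive for `m ≤ 3` (`exists_pos`).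
-/

noncomputable section

namespace FullRank

/-! ### Directional derivatives of matrix expressions -/

section Calculus

attribute [local instance] Matrix.normedAddCommGroup Matrix.normedSpace

/-- `f` is Fréchet differentiable at `a`, and its derivative in the direction `w` is `f' w`. -/
def HasDirDeriv {E F : Type*} [AddCommGroup E] [Module ℝ E] [TopologicalSpace E]
    [AddCommGroup F] [Module ℝ F] [TopologicalSpace F] (f : E → F) (f' : E → F) (a : E) : Prop :=
  ∃ L : E →L[ℝ] F, HasFDerivAt f L a ∧ ∀ w, L w = f' w

section calculus

variable {E : Type*} [NormedAddCommGroup E] [NormedSpace ℝ E]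
  {F : Type*} [NormedAddCommGroup F] [NormedSpace ℝ F]

theorem HasDirDeriv.fderiv_apply {f f' : E → F} {a : E} (h : HasDirDeriv f f' a) (w : E) :
    fderiv ℝ f a w = f' w := by
  obtain ⟨L, hL, hw⟩ := h
  rw [hL.fderiv, hw]

theorem HasDirDeriv.congr_deriv {f f' g' : E → F} {a : E} (h : HasDirDeriv f f' a)
    (e : ∀ w, f' w = g' w) : HasDirDeriv f g' a := by
  obtain ⟨L, hL, hw⟩ := h
  exact ⟨L, hL, fun w => (hw w).trans (e w)⟩

theorem hasDirDeriv_const (c : F) (a : E) : HasDirDeriv (fun _ => c) (fun _ => 0) a :=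
  ⟨0, hasFDerivAt_const c a, fun _ => rfl⟩

theorem hasDirDeriv_id (a : E) : HasDirDeriv (fun x : E => x) (fun w => w) a :=
  ⟨_, hasFDerivAt_id a, fun _ => rfl⟩

theorem HasDirDeriv.add {f f' g g' : E → F} {a : E} (hf : HasDirDeriv f f' a)
    (hg : HasDirDeriv g g' a) : HasDirDeriv (fun x => f x + g x) (fun w => f' w + g' w) a := by
  obtain ⟨L, hL, hw⟩ := hf
  obtain ⟨L₁, hL₁, hw₁⟩ := hg
  exact ⟨_, hL.add hL₁, fun w => by simp [hw, hw₁]⟩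

theorem HasDirDeriv.sub {f f' g g' : E → F} {a : E} (hf : HasDirDeriv f f' a)
    (hg : HasDirDeriv g g' a) : HasDirDeriv (fun x => f x - g x) (fun w => f' w - g' w) a := by
  obtain ⟨L, hL, hw⟩ := hf
  obtain ⟨L₁, hL₁, hw₁⟩ := hg
  exact ⟨_, hL.sub hL₁, fun w => by simp [hw, hw₁]⟩

theorem HasDirDeriv.neg {f f' : E → F} {a : E} (hf : HasDirDeriv f f' a) :
    HasDirDeriv (fun x => -f x) (fun w => -f' w) a := by
  obtain ⟨L, hL, hw⟩ := hf
  exact ⟨_, hL.neg, fun w => by simp [hw]⟩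

theorem HasDirDeriv.smul {c c' : E → ℝ} {f f' : E → F} {a : E} (hc : HasDirDeriv c c' a)
    (hf : HasDirDeriv f f' a) :
    HasDirDeriv (fun x => c x • f x) (fun w => c' w • f a + c a • f' w) a := by
  obtain ⟨L, hL, hw⟩ := hf
  obtain ⟨L₁, hL₁, hw₁⟩ := hc
  exact ⟨_, hL₁.smul hL, fun w => by simp [hw, hw₁, add_comm]⟩

variable {k l p : ℕ}

theorem HasDirDeriv.comp {G : Type*} [NormedAddCommGroup G] [NormedSpace ℝ G]
    {g g' : F → G} {f f' : E → F} {a : E} (hg : HasDirDeriv g g' (f a)) (hf : HasDirDeriv f f' a) :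
    HasDirDeriv (fun x => g (f x)) (fun w => g' (f' w)) a := by
  obtain ⟨L, hL, hw⟩ := hf
  obtain ⟨L₁, hL₁, hw₁⟩ := hg
  exact ⟨_, hL₁.comp a hL, fun w => by simp [hw, hw₁]⟩

theorem HasDirDeriv.clm {G : Type*} [NormedAddCommGroup G] [NormedSpace ℝ G]
    {f f' : E → F} {a : E} (hf : HasDirDeriv f f' a) (T : F →L[ℝ] G) :
    HasDirDeriv (fun x => T (f x)) (fun w => T (f' w)) a := by
  obtain ⟨L, hL, hw⟩ := hf
  exact ⟨_, T.hasFDerivAt.comp a hL, fun w => by simp [hw]⟩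

theorem HasDirDeriv.transpose {f f' : E → Matrix (Fin k) (Fin l) ℝ} {a : E}
    (hf : HasDirDeriv f f' a) : HasDirDeriv (fun x => (f x)ᵀ) (fun w => (f' w)ᵀ) a :=
  hf.clm (Matrix.transposeLinearEquiv (Fin k) (Fin l) ℝ ℝ).toLinearMap.toContinuousLinearMap

theorem HasDirDeriv.trace {f f' : E → Matrix (Fin k) (Fin k) ℝ} {a : E}
    (hf : HasDirDeriv f f' a) : HasDirDeriv (fun x => (f x).trace) (fun w => (f' w).trace) a :=
  hf.clm (Matrix.traceLinearMap (Fin k) ℝ ℝ).toContinuousLinearMap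

theorem HasDirDeriv.matrix_mul {f f' : E → Matrix (Fin k) (Fin l) ℝ}
    {g g' : E → Matrix (Fin l) (Fin p) ℝ} {a : E}
    (hf : HasDirDeriv f f' a) (hg : HasDirDeriv g g' a) :
    HasDirDeriv (fun x => f x * g x) (fun w => f' w * g a + f a * g' w) a := by
  obtain ⟨L, hL, hw⟩ := hf
  obtain ⟨L₁, hL₁, hw₁⟩ := hg
  let B : Matrix (Fin k) (Fin l) ℝ →ₗ[ℝ] Matrix (Fin l) (Fin p) ℝ →ₗ[ℝ]
      Matrix (Fin k) (Fin p) ℝ :=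
    LinearMap.mk₂ ℝ (fun x y => x * y) Matrix.add_mul Matrix.smul_mul
      Matrix.mul_add (fun c x y => Matrix.mul_smul x c y)
  refine ⟨_, B.toContinuousBilinearMap.hasFDerivAt_of_bilinear hL hL₁, fun w => ?_⟩
  change B (f a) (L₁ w) + B (L w) (g a) = _
  rw [hw, hw₁, add_comm]
  rfl

theorem hasDirDeriv_inv {A : Matrix (Fin k) (Fin k) ℝ} (hA : IsUnit A.det) :
    HasDirDeriv (fun x : Matrix (Fin k) (Fin k) ℝ => x⁻¹) (fun w => -(A⁻¹ * w * A⁻¹)) A := by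
  obtain ⟨x, rfl⟩ := (Matrix.isUnit_iff_isUnit_det A).2 hA
  -- the derivative does not depend on the norm, so a submultiplicative one may be used here
  have h := @hasFDerivAt_ringInverse ℝ _ (Matrix (Fin k) (Fin k) ℝ) Matrix.linftyOpNormedRing
    inferInstance Matrix.linftyOpNormedAlgebra x
  have e : (fun y : Matrix (Fin k) (Fin k) ℝ => y⁻¹) = Ring.inverse :=
    funext Matrix.nonsing_inv_eq_ringInverse
  rw [e]
  refine ⟨_, h, fun w => ?_⟩
  rw [← Matrix.coe_units_inv]
  rfl

/-- Jacobi's formula at an invertible matrix. -/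
theorem hasDirDeriv_det {A : Matrix (Fin k) (Fin k) ℝ} (hA : IsUnit A.det) :
    HasDirDeriv (fun x : Matrix (Fin k) (Fin k) ℝ => x.det)
      (fun w => A.det * (A⁻¹ * w).trace) A := by
  have hd : DifferentiableAt ℝ (fun x : Matrix (Fin k) (Fin k) ℝ => x.det) A := by
    have hent (i j) : Differentiable ℝ (fun x : Matrix (Fin k) (Fin k) ℝ => x i j) :=
      (Matrix.entryLinearMap ℝ ℝ i j).toContinuousLinearMap.differentiable
    simp only [Matrix.det_apply]
    fun_prop
  refine ⟨_, hd.hasFDerivAt, fun w => ?_⟩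
  refine hd.lineDeriv_eq_fderiv.symm.trans (HasLineDerivAt.lineDeriv ?_)
  -- `det (A + t w) = det A * det (1 + t A⁻¹ w)`, where the second factor is
  -- `1 + t tr (A⁻¹ w) + O(t²)`
  let q : Polynomial ℝ :=
    (1 + (Polynomial.X : Polynomial ℝ) • (A⁻¹ * w).map Polynomial.C).det.divX.divX
  have e (t : ℝ) : (A + t • w).det =
      A.det * (1 + (A⁻¹ * w).trace * t + q.eval t * t ^ 2) := by
    rw [← Matrix.det_one_add_smul, ← Matrix.det_mul, Matrix.mul_add, Matrix.mul_one,
      Matrix.mul_smul, Matrix.mul_nonsing_inv_cancel_left _ _ hA]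
  simp only [HasLineDerivAt, e]
  have hp := q.hasDerivAt 0
  have := ((((hasDerivAt_id (0 : ℝ)).const_mul (A⁻¹ * w).trace).const_add 1).add
    (hp.mul ((hasDerivAt_id (0 : ℝ)).pow 2))).const_mul A.det
  convert! this using 1
  simp

end calculus

/-! ### The Christoffel map and the curvature tensor in closed form -/

variable {n m : ℕ}

/-- The inverse Gram matrix `(aᵀ a)⁻¹`. -/
def gramInv (a : Matrix (Fin n) (Fin m) ℝ) : Matrix (Fin m) (Fin m) ℝ := (aᵀ * a)⁻¹

/-- The derivative of the Gram matrix `aᵀ a` in the direction `w`. -/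
def gramDeriv (a w : Matrix (Fin n) (Fin m) ℝ) : Matrix (Fin m) (Fin m) ℝ := wᵀ * a + aᵀ * w

/-- The Christoffel map of the metric, in closed form. -/
def chris (a u v : Matrix (Fin n) (Fin m) ℝ) : Matrix (Fin n) (Fin m) ℝ :=
  (1 / 2 : ℝ) • (-(v * gramInv a * gramDeriv a u) - u * gramInv a * gramDeriv a v
    + a * gramInv a * (vᵀ * u + uᵀ * v) + (u * gramInv a * aᵀ).trace • v
    + (v * gramInv a * aᵀ).trace • u - (u * gramInv a * vᵀ).trace • a)

/-- The derivative of `x ↦ chris x v w` at `a` in the direction `u`, in closed form. -/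
def chrisDeriv (a u v w : Matrix (Fin n) (Fin m) ℝ) : Matrix (Fin n) (Fin m) ℝ :=
  let S := gramInv a
  let B := gramDeriv a
  (1 / 2 : ℝ) • (v * S * B u * S * B w - v * S * (wᵀ * u + uᵀ * w)
    + w * S * B u * S * B v - w * S * (vᵀ * u + uᵀ * v)
    + (u * S * (wᵀ * v + vᵀ * w) - a * S * B u * S * (wᵀ * v + vᵀ * w))
    + ((v * S * uᵀ).trace - (v * S * B u * S * aᵀ).trace) • w
    + ((w * S * uᵀ).trace - (w * S * B u * S * aᵀ).trace) • v
    + (v * S * B u * S * wᵀ).trace • a - (v * S * wᵀ).trace • u)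

theorem isUnit_det_gram {a : Matrix (Fin n) (Fin m) ℝ} (ha : a ∈ MPlus n m) :
    IsUnit (aᵀ * a).det := by
  have h : (aᵀ * a).rank = m := by rw [Matrix.rank_transpose_mul_self]; exact ha
  have h2 : LinearIndependent ℝ (aᵀ * a).col := by
    rw [linearIndependent_iff_card_eq_finrank_span, Set.finrank,
      ← Matrix.rank_eq_finrank_span_cols, h]
    simp
  rw [← Matrix.isUnit_iff_isUnit_det]
  exact Matrix.linearIndependent_cols_iff_isUnit.1 h2

theorem det_gram_pos {a : Matrix (Fin n) (Fin m) ℝ} (ha : IsUnit (aᵀ * a).det) :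
    0 < (aᵀ * a).det := by
  have h := (Matrix.posSemidef_conjTranspose_mul_self a).det_nonneg
  rw [Matrix.conjTranspose_eq_transpose_of_trivial] at h
  exact lt_of_le_of_ne h (Ne.symm ha.ne_zero)

theorem eventually_isUnit_det_gram {a : Matrix (Fin n) (Fin m) ℝ} (ha : IsUnit (aᵀ * a).det) :
    ∀ᶠ x in nhds a, IsUnit (xᵀ * x).det := by
  have hc : Continuous fun x : Matrix (Fin n) (Fin m) ℝ => (xᵀ * x).det := by fun_prop
  filter_upwards [hc.continuousAt.eventually_ne ha.ne_zero] with x hx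
  exact isUnit_iff_ne_zero.2 hx

theorem gramInv_transpose (a : Matrix (Fin n) (Fin m) ℝ) : (gramInv a)ᵀ = gramInv a := by
  rw [gramInv, Matrix.transpose_nonsing_inv, Matrix.transpose_mul, Matrix.transpose_transpose]

theorem hasDirDeriv_gram (a : Matrix (Fin n) (Fin m) ℝ) :
    HasDirDeriv (fun x => xᵀ * x) (gramDeriv a) a :=
  (hasDirDeriv_id a).transpose.matrix_mul (hasDirDeriv_id a)

theorem hasDirDeriv_gramInv {a : Matrix (Fin n) (Fin m) ℝ} (ha : IsUnit (aᵀ * a).det) :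
    HasDirDeriv gramInv (fun w => -(gramInv a * gramDeriv a w * gramInv a)) a :=
  HasDirDeriv.comp (g := fun x => x⁻¹)
    (g' := fun w => -(gramInv a * w * gramInv a)) (f := fun x => xᵀ * x)
    (hasDirDeriv_inv ha) (hasDirDeriv_gram a)

theorem hasDirDeriv_sqrt_det_gram {a : Matrix (Fin n) (Fin m) ℝ} (ha : IsUnit (aᵀ * a).det) :
    HasDirDeriv (fun x : Matrix (Fin n) (Fin m) ℝ => √(xᵀ * x).det)
      (fun w => √(aᵀ * a).det * (w * gramInv a * aᵀ).trace) a := by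
  obtain ⟨L, hL, hw⟩ := HasDirDeriv.comp (f := fun x => xᵀ * x)
    (hasDirDeriv_det ha) (hasDirDeriv_gram a)
  refine ⟨_, hL.sqrt ha.ne_zero, fun w => ?_⟩
  have hp := det_gram_pos ha
  have hs := Real.mul_self_sqrt hp.le
  have hs0 : √(aᵀ * a).det ≠ 0 := (Real.sqrt_pos.2 hp).ne'
  have e : (gramInv a * gramDeriv a w).trace = 2 * (w * gramInv a * aᵀ).trace := by
    have h1 : (gramInv a * (wᵀ * a)).trace = (w * gramInv a * aᵀ).trace := by
      rw [← Matrix.trace_transpose, Matrix.trace_mul_comm (w * gramInv a)]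
      simp only [Matrix.transpose_mul, Matrix.transpose_transpose, gramInv_transpose,
        Matrix.mul_assoc]
    have h2 : (gramInv a * (aᵀ * w)).trace = (w * gramInv a * aᵀ).trace := by
      rw [Matrix.mul_assoc, Matrix.trace_mul_comm w, Matrix.mul_assoc]
    rw [gramDeriv, Matrix.mul_add, Matrix.trace_add, h1, h2, two_mul]
  change (1 / (2 * √(aᵀ * a).det)) * L w = _
  rw [hw]
  change (1 / (2 * √(aᵀ * a).det)) * ((aᵀ * a).det * (gramInv a * gramDeriv a w).trace) = _
  rw [e]
  field_simp
  linear_combination (-(w * gramInv a * aᵀ).trace) * hs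

theorem hasDirDeriv_metric {a : Matrix (Fin n) (Fin m) ℝ} (ha : IsUnit (aᵀ * a).det)
    (u v : Matrix (Fin n) (Fin m) ℝ) :
    HasDirDeriv (fun x => metric x u v) (fun w => √(aᵀ * a).det *
      ((w * gramInv a * aᵀ).trace * (u * gramInv a * vᵀ).trace
        - (u * gramInv a * gramDeriv a w * gramInv a * vᵀ).trace)) a := by
  refine ((((hasDirDeriv_const u a).matrix_mul (hasDirDeriv_gramInv ha)).matrix_mul
    (hasDirDeriv_const vᵀ a)).trace.smul (hasDirDeriv_sqrt_det_gram ha)).congr_deriv fun w => ?_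
  simp [Matrix.mul_assoc]
  ring

/-- Nondegeneracy of the metric, up to the factor `√det (aᵀ a)`. -/
theorem eq_zero_of_trace_gramInv {a : Matrix (Fin n) (Fin m) ℝ} (ha : IsUnit (aᵀ * a).det)
    {c : Matrix (Fin n) (Fin m) ℝ} (h : ∀ w, (c * gramInv a * wᵀ).trace = 0) : c = 0 := by
  have h1 : c * gramInv a = 0 := by
    have := h (c * gramInv a)
    rw [← Matrix.conjTranspose_eq_transpose_of_trivial] at this
    exact Matrix.trace_mul_conjTranspose_self_eq_zero_iff.1 this
  have h2 := congrArg (· * (aᵀ * a)) h1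
  simpa [gramInv, Matrix.mul_assoc, Matrix.nonsing_inv_mul _ ha] using h2

/-- The closed form satisfies the Koszul formula, up to the factor `√det (aᵀ a)`. -/
theorem trace_chris (a u v w : Matrix (Fin n) (Fin m) ℝ) :
    2 * (chris a u v * gramInv a * wᵀ).trace =
      (u * gramInv a * aᵀ).trace * (v * gramInv a * wᵀ).trace
        - (v * gramInv a * gramDeriv a u * gramInv a * wᵀ).trace
      + ((v * gramInv a * aᵀ).trace * (u * gramInv a * wᵀ).trace
        - (u * gramInv a * gramDeriv a v * gramInv a * wᵀ).trace)
      - ((w * gramInv a * aᵀ).trace * (u * gramInv a * vᵀ).trace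
        - (u * gramInv a * gramDeriv a w * gramInv a * vᵀ).trace) := by
  have e1 : (u * gramInv a * gramDeriv a w * gramInv a * vᵀ).trace
      = (a * gramInv a * (vᵀ * u + uᵀ * v) * gramInv a * wᵀ).trace := by
    have h1 : (u * gramInv a * (wᵀ * a) * gramInv a * vᵀ).trace
        = (a * gramInv a * (vᵀ * u) * gramInv a * wᵀ).trace := by
      have := Matrix.trace_mul_comm (u * gramInv a * wᵀ) (a * gramInv a * vᵀ)
      simpa only [Matrix.mul_assoc] using this
    have h2 : (u * gramInv a * (aᵀ * w) * gramInv a * vᵀ).trace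
        = (a * gramInv a * (uᵀ * v) * gramInv a * wᵀ).trace := by
      rw [← Matrix.trace_transpose]
      have := Matrix.trace_mul_comm (v * gramInv a * wᵀ) (a * gramInv a * uᵀ)
      simpa only [Matrix.transpose_mul, Matrix.transpose_transpose, gramInv_transpose,
        Matrix.mul_assoc] using this
    simp only [gramDeriv, Matrix.mul_add, Matrix.add_mul, Matrix.trace_add, h1, h2]
  have e2 : (w * gramInv a * aᵀ).trace = (a * gramInv a * wᵀ).trace := by
    rw [← Matrix.trace_transpose]
    simp [gramInv_transpose, Matrix.mul_assoc]
  rw [e1, e2, chris]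
  simp only [Matrix.smul_mul, Matrix.add_mul, Matrix.sub_mul, Matrix.neg_mul, Matrix.trace_smul,
    Matrix.trace_add, Matrix.trace_sub, Matrix.trace_neg, smul_eq_mul]
  ring

theorem christoffel_metric {a : Matrix (Fin n) (Fin m) ℝ} (ha : IsUnit (aᵀ * a).det)
    (u v : Matrix (Fin n) (Fin m) ℝ) : christoffel metric a u v = chris a u v := by
  have hd : √(aᵀ * a).det ≠ 0 := (Real.sqrt_pos.2 (det_gram_pos ha)).ne'
  have key (c : Matrix (Fin n) (Fin m) ℝ) : (∀ w : Matrix (Fin n) (Fin m) ℝ,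
      2 * metric a c w =
        fderiv ℝ (fun x => metric x v w) a u + fderiv ℝ (fun x => metric x u w) a v
          - fderiv ℝ (fun x => metric x u v) a w) ↔ c = chris a u v := by
    have e (w : Matrix (Fin n) (Fin m) ℝ) :
        fderiv ℝ (fun x => metric x v w) a u + fderiv ℝ (fun x => metric x u w) a v
          - fderiv ℝ (fun x => metric x u v) a w = 2 * metric a (chris a u v) w := by
      have h1 := (hasDirDeriv_metric ha v w).fderiv_apply u
      have h2 := (hasDirDeriv_metric ha u w).fderiv_apply v
      have h3 := (hasDirDeriv_metric ha u v).fderiv_apply w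
      refine (congrArg₂ (· - ·) (congrArg₂ (· + ·) h1 h2) h3).trans ?_
      have := trace_chris a u v w
      simp only [metric]
      change _ = 2 * ((chris a u v * gramInv a * wᵀ).trace * _)
      linear_combination (-√(aᵀ * a).det) * this
    constructor
    · intro h
      rw [← sub_eq_zero]
      refine eq_zero_of_trace_gramInv ha fun w => ?_
      have := (h w).trans (e w)
      simp only [metric] at this
      have h2 := mul_right_cancel₀ hd (mul_left_cancel₀ two_ne_zero this)
      have h3 : ((c - chris a u v) * gramInv a * wᵀ).trace =
          (c * gramInv a * wᵀ).trace - (chris a u v * gramInv a * wᵀ).trace := by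
        rw [Matrix.sub_mul, Matrix.sub_mul, Matrix.trace_sub]
      exact h3.trans (sub_eq_zero.2 h2)
    · rintro rfl w
      exact (e w).symm
  exact (key _).1 (Classical.epsilon_spec (p := fun c => ∀ w : Matrix (Fin n) (Fin m) ℝ,
      2 * metric a c w =
        fderiv ℝ (fun x => metric x v w) a u + fderiv ℝ (fun x => metric x u w) a v
          - fderiv ℝ (fun x => metric x u v) a w) ⟨chris a u v, (key _).2 rfl⟩)

theorem hasDirDeriv_chris {a : Matrix (Fin n) (Fin m) ℝ} (ha : IsUnit (aᵀ * a).det)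
    (v w : Matrix (Fin n) (Fin m) ℝ) :
    HasDirDeriv (fun x => chris x v w) (fun u => chrisDeriv a u v w) a := by
  have hS := hasDirDeriv_gramInv ha
  have hid := hasDirDeriv_id a
  have hc (z : Matrix (Fin n) (Fin m) ℝ) := hasDirDeriv_const z a
  have hB (z : Matrix (Fin n) (Fin m) ℝ) : HasDirDeriv (fun x => gramDeriv x z)
      (fun u => zᵀ * u + uᵀ * z) a :=
    (((hc z).transpose.matrix_mul hid).add (hid.transpose.matrix_mul (hc z))).congr_deriv
      fun u => by simp
  have h1 (y z : Matrix (Fin n) (Fin m) ℝ) := (((hc y).matrix_mul hS).matrix_mul (hB z))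
  have h2 := (hid.matrix_mul hS).matrix_mul (hasDirDeriv_const (wᵀ * v + vᵀ * w) a)
  have h3 (y z : Matrix (Fin n) (Fin m) ℝ) :=
    (((hc y).matrix_mul hS).matrix_mul hid.transpose).trace.smul (hc z)
  have h4 := (((hc v).matrix_mul hS).matrix_mul (hasDirDeriv_const wᵀ a)).trace.smul hid
  refine ((hasDirDeriv_const (1 / 2 : ℝ) a).smul ((((((h1 w v).neg.sub (h1 v w)).add h2).add
    (h3 v w)).add (h3 w v)).sub h4)).congr_deriv fun u => ?_
  simp only [chrisDeriv, Matrix.mul_neg, Matrix.neg_mul, Matrix.zero_mul, zero_add, zero_smul,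
    smul_zero, Matrix.mul_zero, add_zero, Matrix.trace_add, Matrix.trace_neg, neg_smul, add_smul,
    sub_smul, Matrix.mul_assoc, Matrix.add_mul]
  module

/-- The curvature tensor of the metric in closed form. -/
def curv (a u v w : Matrix (Fin n) (Fin m) ℝ) : Matrix (Fin n) (Fin m) ℝ :=
  chrisDeriv a u v w - chrisDeriv a v u w + chris a u (chris a v w) - chris a v (chris a u w)

theorem riemannCurvature_metric {a : Matrix (Fin n) (Fin m) ℝ} (ha : IsUnit (aᵀ * a).det)
    (u v w : Matrix (Fin n) (Fin m) ℝ) : riemannCurvature metric a u v w = curv a u v w := by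
  have e (y z : Matrix (Fin n) (Fin m) ℝ) :
      fderiv ℝ (fun x => christoffel metric x y z) a = fderiv ℝ (fun x => chris x y z) a := by
    refine Filter.EventuallyEq.fderiv_eq (𝕜 := ℝ) ?_
    filter_upwards [eventually_isUnit_det_gram ha] with x hx
    exact christoffel_metric hx y z
  rw [riemannCurvature, e, e, curv, christoffel_metric ha, christoffel_metric ha,
    christoffel_metric ha, christoffel_metric ha]
  congr 3
  · exact (hasDirDeriv_chris ha v w).fderiv_apply u
  · exact (hasDirDeriv_chris ha u w).fderiv_apply v

end Calculus

variable {n m : ℕ}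

/-! ### Cyclic rotation and transposition of traces of words -/

section traces

variable {k : ℕ} (A B C D E : Matrix (Fin k) (Fin k) ℝ)

theorem trace_rotate₃ : (A * (B * C)).trace = (B * (C * A)).trace := by
  rw [Matrix.trace_mul_comm]; simp only [Matrix.mul_assoc]

theorem trace_rotate₄ : (A * (B * (C * D))).trace = (B * (C * (D * A))).trace := by
  rw [Matrix.trace_mul_comm]; simp only [Matrix.mul_assoc]

theorem trace_rotate₅ :
    (A * (B * (C * (D * E)))).trace = (B * (C * (D * (E * A)))).trace := by
  rw [Matrix.trace_mul_comm]; simp only [Matrix.mul_assoc]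

theorem trace_reverse₂ : (A * B).trace = (Bᵀ * Aᵀ).trace := by
  rw [← Matrix.trace_transpose]; simp only [Matrix.transpose_mul]

theorem trace_reverse₃ : (A * (B * C)).trace = (Cᵀ * (Bᵀ * Aᵀ)).trace := by
  rw [← Matrix.trace_transpose]; simp only [Matrix.transpose_mul, Matrix.mul_assoc]

theorem trace_reverse₄ : (A * (B * (C * D))).trace = (Dᵀ * (Cᵀ * (Bᵀ * Aᵀ))).trace := by
  rw [← Matrix.trace_transpose]; simp only [Matrix.transpose_mul, Matrix.mul_assoc]

end traces

/-! ### Passage to square matrices -/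

/-- The Christoffel map in terms of the square matrices `U = u a⁺`, `V = v a⁺`; the matrix `P`
stands for the orthogonal projection `a a⁺`. -/
def chrisSq (P U V : Matrix (Fin n) (Fin n) ℝ) : Matrix (Fin n) (Fin n) ℝ :=
  (1 / 2 : ℝ) • (-(V * (Uᵀ * P + P * U)) - U * (Vᵀ * P + P * V) + (Vᵀ * U + Uᵀ * V)
    + U.trace • V + V.trace • U - (U * Vᵀ).trace • P)

/-- The derivative of the Christoffel map in terms of square matrices. -/
def chrisDerivSq (P U V W : Matrix (Fin n) (Fin n) ℝ) : Matrix (Fin n) (Fin n) ℝ :=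
  let B := fun X : Matrix (Fin n) (Fin n) ℝ => Xᵀ * P + P * X
  (1 / 2 : ℝ) • (V * B U * B W - V * (Wᵀ * U + Uᵀ * W)
    + W * B U * B V - W * (Vᵀ * U + Uᵀ * V)
    + (U * (Wᵀ * V + Vᵀ * W) - B U * (Wᵀ * V + Vᵀ * W))
    + ((V * Uᵀ).trace - (V * B U).trace) • W
    + ((W * Uᵀ).trace - (W * B U).trace) • V
    + (V * B U * Wᵀ).trace • P - (V * Wᵀ).trace • U)

/-- The curvature tensor in terms of square matrices. -/
def curvSq (P U V W : Matrix (Fin n) (Fin n) ℝ) : Matrix (Fin n) (Fin n) ℝ :=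
  chrisDerivSq P U V W - chrisDerivSq P V U W + chrisSq P U (chrisSq P V W)
    - chrisSq P V (chrisSq P U W)

theorem gramInv_mul_gram {a : Matrix (Fin n) (Fin m) ℝ} (ha : IsUnit (aᵀ * a).det) :
    gramInv a * (aᵀ * a) = 1 := Matrix.nonsing_inv_mul _ ha

theorem gramInv_mul_gram_mul {a : Matrix (Fin n) (Fin m) ℝ} (ha : IsUnit (aᵀ * a).det) {k : ℕ}
    (X : Matrix (Fin m) (Fin k) ℝ) : gramInv a * (aᵀ * (a * X)) = X := by
  rw [← Matrix.mul_assoc aᵀ, ← Matrix.mul_assoc, gramInv_mul_gram ha, Matrix.one_mul]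

theorem pinv_eq (a : Matrix (Fin n) (Fin m) ℝ) : pinv a = gramInv a * aᵀ := rfl

theorem pinv_mul {a : Matrix (Fin n) (Fin m) ℝ} (ha : IsUnit (aᵀ * a).det) :
    pinv a * a = 1 := by
  rw [pinv_eq, Matrix.mul_assoc, gramInv_mul_gram ha]

theorem proj_mul_proj {a : Matrix (Fin n) (Fin m) ℝ} (ha : IsUnit (aᵀ * a).det) :
    (a * pinv a) * (a * pinv a) = a * pinv a := by
  rw [Matrix.mul_assoc, ← Matrix.mul_assoc (pinv a), pinv_mul ha, Matrix.one_mul]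

theorem proj_transpose (a : Matrix (Fin n) (Fin m) ℝ) : (a * pinv a)ᵀ = a * pinv a := by
  simp [pinv_eq, gramInv_transpose, Matrix.mul_assoc]

theorem trace_proj {a : Matrix (Fin n) (Fin m) ℝ} (ha : IsUnit (aᵀ * a).det) :
    (a * pinv a).trace = m := by
  rw [Matrix.trace_mul_comm, pinv_mul ha, Matrix.trace_one, Fintype.card_fin]

theorem mul_pinv_mul_proj {a : Matrix (Fin n) (Fin m) ℝ} (ha : IsUnit (aᵀ * a).det)
    (u : Matrix (Fin n) (Fin m) ℝ) : (u * pinv a) * (a * pinv a) = u * pinv a := by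
  rw [Matrix.mul_assoc, ← Matrix.mul_assoc (pinv a), pinv_mul ha, Matrix.one_mul]

/-- The metric in terms of square matrices is `tr (U Vᵀ)`, up to the factor `√det (aᵀ a)`. -/
theorem trace_gramInv_eq {a : Matrix (Fin n) (Fin m) ℝ} (ha : IsUnit (aᵀ * a).det)
    (u v : Matrix (Fin n) (Fin m) ℝ) :
    (u * gramInv a * vᵀ).trace = ((u * pinv a) * (v * pinv a)ᵀ).trace := by
  simp only [pinv_eq, Matrix.transpose_mul, Matrix.transpose_transpose, gramInv_transpose,
    Matrix.mul_assoc, gramInv_mul_gram_mul ha]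

theorem chris_mul_pinv {a : Matrix (Fin n) (Fin m) ℝ} (ha : IsUnit (aᵀ * a).det)
    (u v : Matrix (Fin n) (Fin m) ℝ) :
    chris a u v * pinv a = chrisSq (a * pinv a) (u * pinv a) (v * pinv a) := by
  simp only [chris, chrisSq, gramDeriv, pinv_eq, Matrix.transpose_mul, Matrix.transpose_transpose,
    gramInv_transpose, Matrix.mul_assoc, gramInv_mul_gram_mul ha, Matrix.mul_add, Matrix.add_mul,
    Matrix.sub_mul, Matrix.neg_mul, Matrix.smul_mul]

theorem chrisDeriv_mul_pinv {a : Matrix (Fin n) (Fin m) ℝ} (ha : IsUnit (aᵀ * a).det)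
    (u v w : Matrix (Fin n) (Fin m) ℝ) :
    chrisDeriv a u v w * pinv a =
      chrisDerivSq (a * pinv a) (u * pinv a) (v * pinv a) (w * pinv a) := by
  simp only [chrisDeriv, chrisDerivSq, gramDeriv, pinv_eq, Matrix.transpose_mul,
    Matrix.transpose_transpose,
    gramInv_transpose, Matrix.mul_assoc, gramInv_mul_gram_mul ha, Matrix.mul_add, Matrix.add_mul,
    Matrix.sub_mul, Matrix.smul_mul]

theorem curv_mul_pinv {a : Matrix (Fin n) (Fin m) ℝ} (ha : IsUnit (aᵀ * a).det)
    (u v w : Matrix (Fin n) (Fin m) ℝ) :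
    curv a u v w * pinv a = curvSq (a * pinv a) (u * pinv a) (v * pinv a) (w * pinv a) := by
  simp only [curv, curvSq, Matrix.add_mul, Matrix.sub_mul, chris_mul_pinv ha,
    chrisDeriv_mul_pinv ha]

section linearity

variable (P U U' V V' W W' : Matrix (Fin n) (Fin n) ℝ) (t : ℝ)

theorem chrisSq_comm : chrisSq P U V = chrisSq P V U := by
  rw [chrisSq, chrisSq, trace_reverse₂ U, Matrix.transpose_transpose]
  module

theorem chrisSq_add_smul : chrisSq P U (V + t • V') = chrisSq P U V + t • chrisSq P U V' := by
  simp only [chrisSq, Matrix.mul_add, Matrix.add_mul, Matrix.transpose_add, Matrix.transpose_smul,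
    Matrix.trace_add, Matrix.trace_smul, Matrix.mul_smul, Matrix.smul_mul, smul_eq_mul]
  module

theorem chrisSq_add_smul_left : chrisSq P (U + t • U') V = chrisSq P U V + t • chrisSq P U' V := by
  rw [chrisSq_comm, chrisSq_add_smul, chrisSq_comm, chrisSq_comm P V U']

theorem chrisDerivSq_add_smul_left :
    chrisDerivSq P (U + t • U') V W = chrisDerivSq P U V W + t • chrisDerivSq P U' V W := by
  simp only [chrisDerivSq, Matrix.mul_add, Matrix.add_mul, Matrix.transpose_add,
    Matrix.transpose_smul,
    Matrix.trace_add, Matrix.trace_smul, Matrix.mul_smul, Matrix.smul_mul, smul_eq_mul]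
  module

theorem chrisDerivSq_add_smul_right :
    chrisDerivSq P U V (W + t • W') = chrisDerivSq P U V W + t • chrisDerivSq P U V W' := by
  simp only [chrisDerivSq, Matrix.mul_add, Matrix.add_mul, Matrix.transpose_add,
    Matrix.transpose_smul,
    Matrix.trace_add, Matrix.trace_smul, Matrix.mul_smul, Matrix.smul_mul, smul_eq_mul]
  module

theorem chrisDerivSq_add_smul_middle :
    chrisDerivSq P U (V + t • V') W = chrisDerivSq P U V W + t • chrisDerivSq P U V' W := by
  simp only [chrisDerivSq, Matrix.mul_add, Matrix.add_mul, Matrix.transpose_add,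
    Matrix.transpose_smul,
    Matrix.trace_add, Matrix.trace_smul, Matrix.mul_smul, Matrix.smul_mul, smul_eq_mul]
  module

end linearity

/-! ### The dilation direction and the trace identity -/

section proj

variable {P U V W : Matrix (Fin n) (Fin n) ℝ}

theorem proj_mul_transpose (hPt : Pᵀ = P) (hU : U * P = U) : P * Uᵀ = Uᵀ := by
  have := congrArg Matrix.transpose hU
  rwa [Matrix.transpose_mul, hPt] at this

theorem mul_proj_mul (hU : U * P = U) (X : Matrix (Fin n) (Fin n) ℝ) : U * (P * X) = U * X := by
  rw [← Matrix.mul_assoc, hU]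

theorem proj_mul_transpose_mul (hPt : Pᵀ = P) (hU : U * P = U) (X : Matrix (Fin n) (Fin n) ℝ) :
    P * (Uᵀ * X) = Uᵀ * X := by
  rw [← Matrix.mul_assoc, proj_mul_transpose hPt hU]

/-- As `Γ_x(u, x) = (m - 2) / 2 • u`, the covariant derivative of the dilation field `x ↦ x` is a
constant multiple of the identity. -/
theorem chrisSq_proj (hPt : Pᵀ = P) (hPP : P * P = P) (hU : U * P = U) :
    chrisSq P U P = ((P.trace - 2) / 2) • U := by
  simp only [chrisSq, hPt, hPP, hU, Matrix.mul_add, ← Matrix.mul_assoc,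
    proj_mul_transpose hPt hU]
  module

/-- Obtained by differentiating the identity `Γ_x(v, x) = (m - 2) / 2 • v` in `x`. -/
theorem chrisDerivSq_proj_right (hPt : Pᵀ = P) (hPP : P * P = P) (hU : U * P = U)
    (hV : V * P = V) : chrisDerivSq P U V P = -chrisSq P U V := by
  have h : (P * U).trace = U.trace := by rw [Matrix.trace_mul_comm, hU]
  have h' : (Uᵀ * P).trace = U.trace := by
    rw [Matrix.trace_mul_comm, proj_mul_transpose hPt hU, Matrix.trace_transpose]
  simp only [chrisDerivSq, chrisSq, hPt, hPP, hU, hV, Matrix.mul_add, Matrix.add_mul,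
    Matrix.mul_assoc, proj_mul_transpose hPt hU,
    mul_proj_mul hU, mul_proj_mul hV, mul_proj_mul hPP, proj_mul_transpose_mul hPt hU,
    proj_mul_transpose_mul hPt hV, Matrix.trace_add, Matrix.trace_transpose, h, h']
  rw [trace_reverse₂ U, Matrix.transpose_transpose]
  module

theorem chrisDerivSq_proj_middle (hPt : Pᵀ = P) (hPP : P * P = P) (hU : U * P = U)
    (hV : V * P = V) : chrisDerivSq P U P V = -chrisSq P U V := by
  rw [← chrisDerivSq_proj_right hPt hPP hU hV]
  have h' : (P * (U * Vᵀ)).trace = (V * (Uᵀ * P)).trace := by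
    rw [trace_reverse₃ V, hPt, Matrix.transpose_transpose]
  simp only [chrisDerivSq, hPt, hPP, hU, hV, Matrix.mul_add, Matrix.add_mul,
    Matrix.mul_assoc, mul_proj_mul hU, mul_proj_mul hV, mul_proj_mul hPP,
    proj_mul_transpose_mul hPt hU, Matrix.trace_add, h', proj_mul_transpose hPt hU,
    proj_mul_transpose hPt hV]
  rw [← Matrix.trace_transpose (Uᵀ * Vᵀ)]
  simp only [Matrix.transpose_mul, Matrix.transpose_transpose, Matrix.trace_transpose]
  module

/-- Euler's relation: the Christoffel map is homogeneous of degree `-1` in the base point. -/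
theorem chrisDerivSq_proj_left (hPt : Pᵀ = P) (hPP : P * P = P) (hV : V * P = V)
    (hW : W * P = W) : chrisDerivSq P P V W = -chrisSq P V W := by
  simp only [chrisDerivSq, chrisSq, hPt, hPP, hW, hV, Matrix.mul_add, Matrix.add_mul,
    mul_proj_mul hW, mul_proj_mul hV, proj_mul_transpose_mul hPt hW,
    proj_mul_transpose_mul hPt hV, Matrix.trace_add]
  module

theorem chrisSq_mul_proj (hPP : P * P = P) (hU : U * P = U) (hV : V * P = V) :
    chrisSq P U V * P = chrisSq P U V := by
  simp only [chrisSq, Matrix.smul_mul, Matrix.add_mul, Matrix.sub_mul, Matrix.neg_mul,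
    Matrix.mul_add, Matrix.mul_assoc, hPP, hU, hV]

/-- The dilation direction, which corresponds to `P`, lies in the kernel of the curvature. -/
theorem curvSq_add_proj (hPt : Pᵀ = P) (hPP : P * P = P) (hU : U * P = U)
    (hV : V * P = V) (s t : ℝ) :
    curvSq P (U + s • P) (V + t • P) (V + t • P) = curvSq P U V V := by
  have hUV := chrisSq_mul_proj hPP hU hV
  have hVV := chrisSq_mul_proj hPP hV hV
  have e (X : Matrix (Fin n) (Fin n) ℝ) (hX : X * P = X) :
      chrisSq P P X = ((P.trace - 2) / 2) • X := by rw [chrisSq_comm, chrisSq_proj hPt hPP hX]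
  have hsm (c : ℝ) (X Y : Matrix (Fin n) (Fin n) ℝ) : chrisSq P X (c • Y) = c • chrisSq P X Y := by
    have h0 : chrisSq P X 0 = 0 := by simp [chrisSq]
    have := chrisSq_add_smul P X 0 Y c
    rwa [zero_add, h0, zero_add] at this
  have had (X Y Z : Matrix (Fin n) (Fin n) ℝ) :
      chrisSq P X (Y + Z) = chrisSq P X Y + chrisSq P X Z := by
    simpa using chrisSq_add_smul P X Y Z 1
  simp only [curvSq, had, hsm, chrisSq_add_smul_left,
    chrisDerivSq_add_smul_left, chrisDerivSq_add_smul_middle, chrisDerivSq_add_smul_right,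
    chrisDerivSq_proj_right hPt hPP hU hV, chrisDerivSq_proj_right hPt hPP hU hPP,
    chrisDerivSq_proj_right hPt hPP hV hU, chrisDerivSq_proj_middle hPt hPP hV hV,
    chrisDerivSq_proj_middle hPt hPP hU hV, chrisDerivSq_proj_middle hPt hPP hPP hV,
    chrisDerivSq_proj_right hPt hPP hV hPP, chrisDerivSq_proj_right hPt hPP hPP hV,
    chrisDerivSq_proj_right hPt hPP hPP hU, chrisDerivSq_proj_right hPt hPP hPP hPP,
    chrisDerivSq_proj_left hPt hPP hV hV, chrisDerivSq_proj_left hPt hPP hU hV,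
    chrisSq_proj hPt hPP hU, chrisSq_proj hPt hPP hV,
    chrisSq_proj hPt hPP hPP, e U hU, e V hV, e _ hUV, e _ hVV]
  rw [chrisSq_comm P V U]
  module

end proj

/-- The right-hand side of the formula for `4 K / √det (aᵀ a)`, as a function of `P = a a⁺` and of
the traceless parts `U`, `V`; the number `c` stands for the number `m` of columns. -/
def curvForm (c : ℝ) (P U V : Matrix (Fin n) (Fin n) ℝ) : ℝ :=
  2 * (⁅V, U⁆ * ⁅Vᵀ, U⁆).trace
    + 2 * (⁅V, Uᵀ⁆ * ⁅V, U⁆).trace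
    + 2 * (V * U * Vᵀ * Uᵀ).trace
    + (V * Vᵀ * Uᵀ * U).trace
    - 4 * (V * V * Uᵀ * Uᵀ).trace
    + 4 * (V * Uᵀ * U * Vᵀ).trace
    + (Vᵀ * V * U * Uᵀ).trace
    - 2 * (V * Vᵀ * U * Uᵀ).trace
    - 2 * (V * Uᵀ * V * Uᵀ).trace
    + 6 * (V * Uᵀ * V * Uᵀ * P).trace
    - 3 * (V * Uᵀ * U * Vᵀ * P).trace
    - 3 * (U * Vᵀ * V * Uᵀ * P).trace
    - c * (V * Vᵀ).trace * (U * Uᵀ).trace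
    + c * (U * Vᵀ).trace ^ 2

section trace

variable {P U V : Matrix (Fin n) (Fin n) ℝ}

/-- The curvature formula for traceless directions: both sides expand into traces of words in
`U`, `V`, their transposes and `P`, and the words agree up to rotation and transposition. -/
theorem trace_curvSq (hPt : Pᵀ = P) (hPP : P * P = P) (hU : U * P = U) (hV : V * P = V)
    (hU0 : U.trace = 0) (hV0 : V.trace = 0) :
    4 * (curvSq P U V V * Uᵀ).trace = curvForm P.trace P U V := by
  simp only [curvSq, chrisDerivSq, chrisSq, curvForm, Ring.lie_def, hPt, hPP, hU, hV, hU0, hV0,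
    Matrix.mul_add, Matrix.add_mul, Matrix.mul_sub, Matrix.sub_mul, Matrix.mul_neg, Matrix.neg_mul,
    Matrix.smul_mul, Matrix.mul_smul, Matrix.transpose_add, Matrix.transpose_sub,
    Matrix.transpose_neg, Matrix.transpose_smul, Matrix.transpose_mul, Matrix.transpose_transpose,
    Matrix.mul_assoc, proj_mul_transpose hPt hU, proj_mul_transpose hPt hV,
    mul_proj_mul hU, mul_proj_mul hV, mul_proj_mul hPP, proj_mul_transpose_mul hPt hU,
    proj_mul_transpose_mul hPt hV, Matrix.trace_add, Matrix.trace_sub, Matrix.trace_neg,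
    Matrix.trace_smul, Matrix.trace_transpose, smul_eq_mul]
  -- the rewrites below bring every word to a fixed representative of its class
  simp only [hPt, Matrix.transpose_transpose,
    Matrix.trace_mul_comm V U, trace_reverse₂ V Uᵀ, Matrix.trace_mul_comm Uᵀ V,
    Matrix.trace_mul_comm Vᵀ U, Matrix.trace_mul_comm Vᵀ V, trace_reverse₃ V Uᵀ P,
    trace_rotate₃ P U Vᵀ, trace_rotate₄ U V Uᵀ V, trace_rotate₄ V Uᵀ V U, trace_rotate₄ Uᵀ V U V,
    trace_reverse₄ Vᵀ U Vᵀ Uᵀ, trace_rotate₄ Vᵀ V Uᵀ Uᵀ, trace_rotate₄ V Uᵀ Uᵀ Vᵀ,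
    trace_rotate₄ Uᵀ Uᵀ Vᵀ V, trace_reverse₄ V U U Vᵀ, trace_rotate₄ V U Vᵀ U,
    trace_rotate₄ U Vᵀ U V, trace_rotate₄ Vᵀ U V U, trace_reverse₄ Vᵀ Uᵀ V Uᵀ,
    trace_rotate₄ V Uᵀ Vᵀ Uᵀ, trace_rotate₄ Uᵀ Vᵀ Uᵀ V, trace_rotate₅ P U Vᵀ V Uᵀ,
    trace_reverse₄ Vᵀ U V Uᵀ, trace_rotate₄ U Vᵀ Uᵀ V, trace_rotate₄ Vᵀ Uᵀ V U,
    trace_rotate₄ Uᵀ V U Vᵀ, trace_rotate₄ Uᵀ V V Uᵀ, trace_rotate₄ V Uᵀ U V,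
    trace_rotate₄ Uᵀ U V V, trace_reverse₄ U Vᵀ Vᵀ Uᵀ, trace_rotate₄ Uᵀ V Vᵀ Uᵀ,
    trace_reverse₄ U V Vᵀ U, trace_rotate₄ U Vᵀ V Uᵀ, trace_rotate₄ Vᵀ V Uᵀ U,
    trace_rotate₄ U V Vᵀ Uᵀ, trace_rotate₄ Uᵀ V V U, trace_reverse₄ Vᵀ Vᵀ U Uᵀ,
    trace_rotate₄ U Uᵀ V V, trace_rotate₅ P V Uᵀ V Uᵀ, trace_rotate₅ V Uᵀ P V Uᵀ,
    trace_rotate₅ Uᵀ P V Uᵀ V, trace_rotate₅ U Vᵀ P V Uᵀ, trace_rotate₅ Vᵀ P V Uᵀ U,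
    trace_rotate₅ P V Uᵀ U Vᵀ]
  ring

/-- The curvature vector is orthogonal to the dilation direction. -/
theorem trace_curvSq_mul_proj (hPt : Pᵀ = P) (hPP : P * P = P) (hU : U * P = U) (hV : V * P = V)
    (hU0 : U.trace = 0) (hV0 : V.trace = 0) :
    (curvSq P U V V * P).trace = 0 := by
  simp only [curvSq, chrisDerivSq, chrisSq, hPt, hPP, hU, hV, hU0, hV0,
    Matrix.mul_add, Matrix.add_mul, Matrix.mul_sub, Matrix.sub_mul, Matrix.mul_neg, Matrix.neg_mul,
    Matrix.smul_mul, Matrix.mul_smul, Matrix.transpose_add, Matrix.transpose_sub,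
    Matrix.transpose_neg, Matrix.transpose_smul, Matrix.transpose_mul, Matrix.transpose_transpose,
    Matrix.mul_assoc, proj_mul_transpose hPt hV,
    mul_proj_mul hU, mul_proj_mul hV, mul_proj_mul hPP, proj_mul_transpose_mul hPt hU,
    proj_mul_transpose_mul hPt hV, Matrix.trace_add, Matrix.trace_sub, Matrix.trace_neg,
    Matrix.trace_smul, smul_eq_mul]
  simp only [hPt, hV, Matrix.transpose_transpose, proj_mul_transpose hPt hU,
    proj_mul_transpose hPt hV,
    Matrix.trace_mul_comm V U, trace_reverse₂ V Uᵀ, Matrix.trace_mul_comm Uᵀ V,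
    Matrix.trace_mul_comm Vᵀ U, Matrix.trace_mul_comm Vᵀ V, trace_reverse₃ V Uᵀ P,
    trace_rotate₃ P U Vᵀ, trace_rotate₄ P V Uᵀ V, trace_rotate₃ V Uᵀ V, trace_rotate₃ V V Uᵀ,
    trace_reverse₃ Vᵀ Vᵀ U, trace_reverse₄ Vᵀ U Vᵀ P, trace_reverse₄ V V Uᵀ P,
    trace_rotate₄ P U Vᵀ Vᵀ, trace_rotate₄ V Uᵀ P V, trace_rotate₄ Uᵀ P V V,
    trace_rotate₄ P V V Uᵀ, trace_rotate₃ Vᵀ Uᵀ V, trace_rotate₃ Uᵀ V Vᵀ, trace_reverse₃ V Vᵀ U,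
    trace_rotate₃ Vᵀ U V, trace_rotate₃ U V Vᵀ, trace_rotate₄ Uᵀ V Vᵀ P, trace_rotate₃ U V V,
    trace_rotate₃ V U V, trace_rotate₄ P U Vᵀ V, trace_rotate₃ V U Vᵀ, trace_rotate₃ Vᵀ V U,
    trace_reverse₃ V Uᵀ Vᵀ, trace_rotate₃ Uᵀ Vᵀ V, trace_rotate₃ Vᵀ V Uᵀ, trace_rotate₄ Vᵀ V Uᵀ P,
    trace_rotate₄ U Vᵀ P V, trace_rotate₄ Vᵀ P V U, trace_rotate₄ P V U Vᵀ,
    trace_reverse₄ V Uᵀ Vᵀ P, trace_reverse₄ V Vᵀ Uᵀ P,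
    trace_rotate₄ P U V Vᵀ]
  ring

end trace

/-! ### The Gram determinant of two square matrices -/

/-- The Gram determinant of `X`, `Y` for the inner product `tr (X Yᵀ)`. -/
def traceGram (X Y : Matrix (Fin n) (Fin n) ℝ) : ℝ :=
  (X * Xᵀ).trace * (Y * Yᵀ).trace - (X * Yᵀ).trace ^ 2

theorem trace_mul_transpose_self_nonneg (X : Matrix (Fin n) (Fin n) ℝ) : 0 ≤ (X * Xᵀ).trace := by
  have := (Matrix.posSemidef_self_mul_conjTranspose X).trace_nonneg
  rwa [Matrix.conjTranspose_eq_transpose_of_trivial] at this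

theorem trace_mul_transpose_self_eq_zero {X : Matrix (Fin n) (Fin n) ℝ} :
    (X * Xᵀ).trace = 0 ↔ X = 0 := by
  rw [← Matrix.conjTranspose_eq_transpose_of_trivial]
  exact Matrix.trace_mul_conjTranspose_self_eq_zero_iff

/-- Multiplied by the squared norm of `X`, the Gram determinant is the squared norm of a multiple
of the component of `Y` orthogonal to `X`. -/
theorem trace_mul_traceGram (X Y : Matrix (Fin n) (Fin n) ℝ) :
    (X * Xᵀ).trace * traceGram X Y =
      (((X * Xᵀ).trace • Y - (X * Yᵀ).trace • X) *
        ((X * Xᵀ).trace • Y - (X * Yᵀ).trace • X)ᵀ).trace := by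
  have h : (Y * Xᵀ).trace = (X * Yᵀ).trace := by
    rw [trace_reverse₂, Matrix.transpose_transpose]
  simp only [traceGram, Matrix.transpose_sub, Matrix.transpose_smul, Matrix.sub_mul, Matrix.mul_sub,
    Matrix.smul_mul, Matrix.mul_smul, Matrix.trace_sub, Matrix.trace_smul, smul_eq_mul, h]
  ring

theorem traceGram_smul_right (X : Matrix (Fin n) (Fin n) ℝ) (r : ℝ) : traceGram X (r • X) = 0 := by
  simp only [traceGram, Matrix.transpose_smul, Matrix.smul_mul, Matrix.mul_smul, Matrix.trace_smul,
    smul_eq_mul]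
  ring

theorem traceGram_zero_left (Y : Matrix (Fin n) (Fin n) ℝ) : traceGram 0 Y = 0 := by
  simp [traceGram]

theorem eq_zero_or_eq_smul_of_not_linearIndependent {M : Type*} [AddCommGroup M] [Module ℝ M]
    {x y : M} (h : ¬ LinearIndependent ℝ ![x, y]) : x = 0 ∨ ∃ r : ℝ, y = r • x := by
  by_cases hx : x = 0
  · exact Or.inl hx
  · rw [LinearIndependent.pair_iff' hx] at h
    push Not at h
    obtain ⟨r, hr⟩ := h
    exact Or.inr ⟨r, hr.symm⟩

/-- The Cauchy-Schwarz inequality with its equality case. -/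
theorem traceGram_pos {X Y : Matrix (Fin n) (Fin n) ℝ} (h : LinearIndependent ℝ ![X, Y]) :
    0 < traceGram X Y := by
  have hX : X ≠ 0 := h.ne_zero 0
  have hp : 0 < (X * Xᵀ).trace := lt_of_le_of_ne (trace_mul_transpose_self_nonneg X)
    fun e => hX (trace_mul_transpose_self_eq_zero.1 e.symm)
  refine (mul_pos_iff_of_pos_left hp).1 ?_
  rw [trace_mul_traceGram]
  refine lt_of_le_of_ne (trace_mul_transpose_self_nonneg _) fun e => hp.ne' ?_
  have e' := trace_mul_transpose_self_eq_zero.1 e.symm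
  refine (LinearIndependent.pair_iff.1 h (-(X * Yᵀ).trace) (X * Xᵀ).trace ?_).2
  rw [← e']
  module

theorem traceGram_eq_zero {X Y : Matrix (Fin n) (Fin n) ℝ} (h : ¬ LinearIndependent ℝ ![X, Y]) :
    traceGram X Y = 0 := by
  rcases eq_zero_or_eq_smul_of_not_linearIndependent h with rfl | ⟨r, rfl⟩
  · exact traceGram_zero_left Y
  · exact traceGram_smul_right X r

theorem traceGram_nonneg (X Y : Matrix (Fin n) (Fin n) ℝ) : 0 ≤ traceGram X Y := by
  by_cases h : LinearIndependent ℝ ![X, Y]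
  · exact (traceGram_pos h).le
  · exact (traceGram_eq_zero h).ge

/-! ### Reduction to traceless parts -/

section reduction

variable {a : Matrix (Fin n) (Fin m) ℝ}

theorem squareTracelessPart_mul_proj (ha : IsUnit (aᵀ * a).det) (u : Matrix (Fin n) (Fin m) ℝ) :
    squareTracelessPart a u * (a * pinv a) = squareTracelessPart a u := by
  rw [squareTracelessPart, Matrix.sub_mul, Matrix.smul_mul, mul_pinv_mul_proj ha,
    mul_pinv_mul_proj ha]

theorem trace_squareTracelessPart (ha : IsUnit (aᵀ * a).det) (u : Matrix (Fin n) (Fin m) ℝ) :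
    (squareTracelessPart a u).trace = 0 := by
  rw [squareTracelessPart, Matrix.trace_sub, Matrix.trace_smul, trace_proj ha, smul_eq_mul]
  rcases Nat.eq_zero_or_pos m with rfl | hm
  · -- without columns `u` vanishes, and `tr U / m` is a division by zero
    simp [Subsingleton.elim u 0]
  · have : (m : ℝ) ≠ 0 := by positivity
    field_simp
    ring

theorem mul_pinv_eq_add (a u : Matrix (Fin n) (Fin m) ℝ) :
    u * pinv a = squareTracelessPart a u + ((u * pinv a).trace / m) • (a * pinv a) := by
  rw [squareTracelessPart, sub_add_cancel]

theorem tracelessPart_mul_pinv (a u : Matrix (Fin n) (Fin m) ℝ) :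
    tracelessPart a u * pinv a = squareTracelessPart a u := by
  rw [tracelessPart, squareTracelessPart, Matrix.sub_mul, Matrix.smul_mul]

theorem metric_eq (ha : IsUnit (aᵀ * a).det) (u v : Matrix (Fin n) (Fin m) ℝ) :
    metric a u v = ((u * pinv a) * (v * pinv a)ᵀ).trace * √(aᵀ * a).det := by
  rw [← trace_gramInv_eq ha]; rfl

/-- The formula for the numerator of the sectional curvature, for arbitrary `u`, `v`: the trace
parts drop out because the dilation direction is in the kernel of the curvature and orthogonal to
its values. -/
theorem metric_riemannCurvature (ha : IsUnit (aᵀ * a).det) (u v : Matrix (Fin n) (Fin m) ℝ) :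
    4 * metric a (riemannCurvature metric a u v v) u =
      curvForm m (a * pinv a) (squareTracelessPart a u) (squareTracelessPart a v)
        * √(aᵀ * a).det := by
  have hPt := proj_transpose a
  have hPP := proj_mul_proj ha
  have hU := squareTracelessPart_mul_proj ha u
  have hV := squareTracelessPart_mul_proj ha v
  have h := trace_curvSq hPt hPP hU hV (trace_squareTracelessPart ha u)
    (trace_squareTracelessPart ha v)
  have h0 := trace_curvSq_mul_proj hPt hPP hU hV (trace_squareTracelessPart ha u)
    (trace_squareTracelessPart ha v)
  rw [metric_eq ha, riemannCurvature_metric ha, curv_mul_pinv ha, mul_pinv_eq_add a u,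
    mul_pinv_eq_add a v, curvSq_add_proj hPt hPP hU hV, Matrix.transpose_add,
    Matrix.transpose_smul, hPt, Matrix.mul_add, Matrix.mul_smul, Matrix.trace_add,
    Matrix.trace_smul, h0, smul_zero, add_zero, ← mul_assoc, h, trace_proj ha]

theorem linearIndependent_mul_pinv (ha : IsUnit (aᵀ * a).det) (u v : Matrix (Fin n) (Fin m) ℝ) :
    LinearIndependent ℝ ![u * pinv a, v * pinv a] ↔ LinearIndependent ℝ ![u, v] := by
  rw [LinearIndependent.pair_iff, LinearIndependent.pair_iff]
  refine forall₂_congr fun s t => ?_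
  have : s • (u * pinv a) + t • (v * pinv a) = 0 ↔ s • u + t • v = 0 := by
    rw [← Matrix.smul_mul, ← Matrix.smul_mul, ← Matrix.add_mul]
    refine ⟨fun h => ?_, fun h => by rw [h, Matrix.zero_mul]⟩
    have := congrArg (· * a) h
    simpa [Matrix.mul_assoc, pinv_mul ha] using this
  rw [this]

theorem sectionalCurvature_metric (ha : IsUnit (aᵀ * a).det) (u v : Matrix (Fin n) (Fin m) ℝ) :
    sectionalCurvature metric a u v =
      curvForm m (a * pinv a) (squareTracelessPart a u) (squareTracelessPart a v) /
        (4 * √(aᵀ * a).det * traceGram (u * pinv a) (v * pinv a)) := by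
  have hd : √(aᵀ * a).det ≠ 0 := (Real.sqrt_pos.2 (det_gram_pos ha)).ne'
  have h := metric_riemannCurvature ha u v
  have h1 : metric a (riemannCurvature metric a u v v) u =
      curvForm m (a * pinv a) (squareTracelessPart a u) (squareTracelessPart a v)
        * √(aᵀ * a).det / 4 := by linarith
  rw [sectionalCurvature, h1, metric_eq ha u u, metric_eq ha v v, metric_eq ha u v]
  have h2 : ((u * pinv a) * (u * pinv a)ᵀ).trace * √(aᵀ * a).det *
      (((v * pinv a) * (v * pinv a)ᵀ).trace * √(aᵀ * a).det) -
      (((u * pinv a) * (v * pinv a)ᵀ).trace * √(aᵀ * a).det) ^ 2 =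
      √(aᵀ * a).det ^ 2 * traceGram (u * pinv a) (v * pinv a) := by
    rw [traceGram]; ring
  rw [h2, div_div, show 4 * (√(aᵀ * a).det ^ 2 * traceGram (u * pinv a) (v * pinv a)) =
    4 * √(aᵀ * a).det * traceGram (u * pinv a) (v * pinv a) * √(aᵀ * a).det by ring,
    mul_div_mul_right _ _ hd]

theorem sectionalCurvature_orthonormal {E : Type*} [AddCommGroup E] [Module ℝ E]
    [TopologicalSpace E] {g : E → E → E → ℝ} {x u v : E} (h : IsOrthonormalPair g x u v) :
    sectionalCurvature g x u v = g x (riemannCurvature g x u v v) u := by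
  rw [sectionalCurvature, h.1, h.2.1, h.2.2]
  norm_num

theorem squareTracelessPart_eq_zero (ha : IsUnit (aᵀ * a).det) {u : Matrix (Fin n) (Fin m) ℝ}
    (hu : IsPureTrace a u) : squareTracelessPart a u = 0 := by
  obtain ⟨c, rfl⟩ := hu
  rcases Nat.eq_zero_or_pos m with rfl | hm
  · simp [squareTracelessPart, Subsingleton.elim a 0]
  · have : (m : ℝ) ≠ 0 := by positivity
    rw [squareTracelessPart, Matrix.smul_mul, Matrix.trace_smul, trace_proj ha, smul_eq_mul,
      mul_div_cancel_right₀ _ this, sub_self]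

end reduction

/-! ### Special cases of the curvature form -/

section forms

variable {P U V : Matrix (Fin n) (Fin n) ℝ} (c : ℝ)

theorem curvForm_zero_left (P V : Matrix (Fin n) (Fin n) ℝ) : curvForm c P 0 V = 0 := by
  simp [curvForm, Ring.lie_def]

theorem curvForm_zero_right (P U : Matrix (Fin n) (Fin n) ℝ) : curvForm c P U 0 = 0 := by
  simp [curvForm, Ring.lie_def]

theorem curvForm_smul (P U V : Matrix (Fin n) (Fin n) ℝ) (r : ℝ) :
    curvForm c P (r • U) (r • V) = r ^ 4 * curvForm c P U V := by
  simp only [curvForm, Ring.lie_def, Matrix.transpose_smul, Matrix.smul_mul, Matrix.mul_smul,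
    smul_smul, ← smul_sub, Matrix.trace_smul, smul_eq_mul]
  ring

/-- On horizontal vectors the curvature form is a combination, with coefficients `-7` and `-c`, of
`‖[U, V]‖²` and the Gram determinant. -/
theorem curvForm_of_isSymm (hU : U * P = U) (hV : V * P = V) (hUs : U.IsSymm) (hVs : V.IsSymm) :
    curvForm c P U V = -7 * (⁅U, V⁆ * ⁅U, V⁆ᵀ).trace - c * traceGram U V := by
  simp only [curvForm, traceGram, Ring.lie_def, hUs.eq, hVs.eq, Matrix.transpose_sub,
    Matrix.transpose_mul, Matrix.mul_sub, Matrix.sub_mul, Matrix.mul_assoc, hU, hV,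
    Matrix.trace_sub, trace_rotate₄ U V U V, trace_rotate₄ U V V U,
    trace_rotate₄ V U U V, trace_rotate₄ U U V V]
  ring

/-- The curvature form on vectors whose columns are orthogonal to the range of `a`. -/
theorem curvForm_of_proj_mul_eq_zero (hPt : Pᵀ = P) (hU : U * P = U) (hV : V * P = V)
    (hPU : P * U = 0) (hPV : P * V = 0) :
    curvForm c P U V = 4 * ((Vᵀ * V) * (Uᵀ * U)).trace - 2 * ((Uᵀ * V) * (Uᵀ * V)ᵀ).trace
      - 2 * ((Uᵀ * V) * (Uᵀ * V)).trace - c * traceGram U V := by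
  have z {X Y : Matrix (Fin n) (Fin n) ℝ} (hX : X * P = X) (hY : P * Y = 0) : X * Y = 0 := by
    rw [← hX, Matrix.mul_assoc, hY, Matrix.mul_zero]
  have t {X Y : Matrix (Fin n) (Fin n) ℝ} (h : X * Y = 0) : Yᵀ * Xᵀ = 0 := by
    rw [← Matrix.transpose_mul, h, Matrix.transpose_zero]
  have hUP := t hPU
  have hVP := t hPV
  rw [hPt] at hUP hVP
  simp only [curvForm, traceGram, Ring.lie_def, Matrix.mul_sub, Matrix.sub_mul, Matrix.mul_assoc,
    Matrix.transpose_mul, Matrix.transpose_transpose,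
    z hU hPV, z hV hPU, z hV hPV, t (z hU hPV), hUP, hVP, Matrix.mul_zero, Matrix.zero_mul,
    Matrix.trace_zero, Matrix.trace_sub, trace_rotate₄ Uᵀ U Vᵀ V, trace_rotate₄ U Vᵀ V Uᵀ,
    trace_rotate₄ V Uᵀ U Vᵀ, trace_rotate₄ V Uᵀ V Uᵀ]
  rw [trace_rotate₄ V Vᵀ U Uᵀ, trace_rotate₄ Vᵀ U Uᵀ V, trace_rotate₄ U Uᵀ V Vᵀ]
  ring

end forms

/-! ### One column -/

section rank_one

variable {a : Matrix (Fin n) (Fin 1) ℝ}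

/-- For one column `a a⁺` has rank one, so compressing a matrix by it gives a multiple of `a a⁺`. -/
theorem proj_mul_mul_proj (a : Matrix (Fin n) (Fin 1) ℝ) (X : Matrix (Fin n) (Fin n) ℝ) :
    (a * pinv a) * X * (a * pinv a) = (X * (a * pinv a)).trace • (a * pinv a) := by
  have h : pinv a * X * a = (X * (a * pinv a)).trace • (1 : Matrix (Fin 1) (Fin 1) ℝ) := by
    have e : (X * (a * pinv a)).trace = (pinv a * X * a).trace := by
      rw [← Matrix.mul_assoc, Matrix.trace_mul_comm, ← Matrix.mul_assoc]
    rw [e]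
    ext i j
    fin_cases i; fin_cases j
    simp [Matrix.trace]
  calc (a * pinv a) * X * (a * pinv a) = a * (pinv a * X * a) * pinv a := by
        simp only [Matrix.mul_assoc]
    _ = _ := by rw [h, Matrix.mul_smul, Matrix.mul_one, Matrix.smul_mul]

/-- For one column the curvature form is three times the Gram determinant. -/
theorem curvForm_one_column (ha : IsUnit (aᵀ * a).det) {U V : Matrix (Fin n) (Fin n) ℝ}
    (hU : U * (a * pinv a) = U) (hV : V * (a * pinv a) = V) (hU0 : U.trace = 0)
    (hV0 : V.trace = 0) : curvForm (1 : ℕ) (a * pinv a) U V = 3 * traceGram U V := by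
  have hPt := proj_transpose a
  have hP1 := trace_proj ha
  have key {X : Matrix (Fin n) (Fin n) ℝ} (hX : X * (a * pinv a) = X) (h0 : X.trace = 0) :
      (a * pinv a) * X = 0 := by
    have := proj_mul_mul_proj a X
    rwa [Matrix.mul_assoc, hX, h0, zero_smul] at this
  have key2 {X Y : Matrix (Fin n) (Fin n) ℝ} (hX : X * (a * pinv a) = X)
      (hY : Y * (a * pinv a) = Y) : Xᵀ * Y = (Xᵀ * Y).trace • (a * pinv a) := by
    have := proj_mul_mul_proj a (Xᵀ * Y)
    rwa [Matrix.mul_assoc (a * pinv a) (Xᵀ * Y), Matrix.mul_assoc Xᵀ Y, hY,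
      ← Matrix.mul_assoc (a * pinv a) Xᵀ, proj_mul_transpose hPt hX] at this
  rw [curvForm_of_proj_mul_eq_zero _ hPt hU hV (key hU hU0) (key hV hV0), key2 hU hV, key2 hV hV,
    key2 hU hU]
  simp only [Matrix.transpose_smul, hPt, Matrix.smul_mul, Matrix.mul_smul, Matrix.trace_smul,
    smul_eq_mul, proj_mul_proj ha, hP1, traceGram]
  rw [Matrix.trace_mul_comm Uᵀ U, Matrix.trace_mul_comm Vᵀ V, trace_reverse₂ Uᵀ V,
    Matrix.transpose_transpose, Matrix.trace_mul_comm Vᵀ U]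
  push_cast
  ring

/-- In two dimensions the vectors of trace zero at `a` form a line. -/
theorem not_linearIndependent_tracelessPart {a : Matrix (Fin 2) (Fin 1) ℝ}
    (ha : IsUnit (aᵀ * a).det) (u v : Matrix (Fin 2) (Fin 1) ℝ) :
    ¬ LinearIndependent ℝ ![tracelessPart a u, tracelessPart a v] := by
  intro h
  have hs := h.span_eq_top_of_card_eq_finrank (by simp [Module.finrank_matrix])
  have hmem : a ∈ Submodule.span ℝ (Set.range ![tracelessPart a u, tracelessPart a v]) := by
    rw [hs]; trivial
  rw [Matrix.range_cons, Matrix.range_cons, Matrix.range_empty, Set.union_empty,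
    Set.singleton_union, Submodule.mem_span_pair] at hmem
  obtain ⟨s, t, hst⟩ := hmem
  have h1 := trace_proj ha
  have h2 : ((s • tracelessPart a u + t • tracelessPart a v) * pinv a).trace = 0 := by
    rw [Matrix.add_mul, Matrix.smul_mul, Matrix.smul_mul, tracelessPart_mul_pinv,
      tracelessPart_mul_pinv, Matrix.trace_add, Matrix.trace_smul, Matrix.trace_smul,
      trace_squareTracelessPart ha, trace_squareTracelessPart ha, smul_zero, smul_zero, add_zero]
  rw [hst, h1] at h2
  norm_num at h2

end rank_one

/-! ### Planes of prescribed sign -/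

theorem exists_orthonormal_pair (W : Submodule ℝ (Fin n → ℝ)) (h : 2 ≤ Module.finrank ℝ W) :
    ∃ x ∈ W, ∃ y ∈ W, x ⬝ᵥ x = 1 ∧ y ⬝ᵥ y = 1 ∧ x ⬝ᵥ y = 0 := by
  let e := (WithLp.linearEquiv 2 ℝ (Fin n → ℝ)).symm
  let W' : Submodule ℝ (EuclideanSpace ℝ (Fin n)) := W.map e.toLinearMap
  have hW' : Module.finrank ℝ W' = Module.finrank ℝ W := LinearEquiv.finrank_map_eq e W
  let b := stdOrthonormalBasis ℝ W'
  have hb (i j) : (b i : EuclideanSpace ℝ (Fin n)).ofLp ⬝ᵥ (b j : EuclideanSpace ℝ (Fin n)).ofLp =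
      if j = i then 1 else 0 := by
    have := orthonormal_iff_ite.1 b.orthonormal j i
    rwa [Submodule.coe_inner, EuclideanSpace.inner_eq_star_dotProduct, star_trivial] at this
  have hmem (i) : (b i : EuclideanSpace ℝ (Fin n)).ofLp ∈ W := by
    obtain ⟨w, hw, hwe⟩ := Submodule.mem_map.1 (b i).2
    rw [← hwe]
    exact hw
  let i : Fin (Module.finrank ℝ W') := ⟨0, by omega⟩
  let j : Fin (Module.finrank ℝ W') := ⟨1, by omega⟩
  have hij : j ≠ i := by simp [i, j, Fin.ext_iff]
  exact ⟨_, hmem i, _, hmem j, by simp [hb], by simp [hb], by rw [hb, if_neg hij]⟩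

section existence

variable {a : Matrix (Fin n) (Fin m) ℝ}

/-- Orthogonal square matrices of trace zero and equal norm come, after rescaling, from an
orthonormal pair of tangent vectors. -/
theorem exists_orthonormal_of_square (ha : IsUnit (aᵀ * a).det) {U V : Matrix (Fin n) (Fin n) ℝ}
    (hU : U * (a * pinv a) = U) (hV : V * (a * pinv a) = V) (hU0 : U.trace = 0)
    (hV0 : V.trace = 0) (hUV : (U * Vᵀ).trace = 0) (hq : (V * Vᵀ).trace = (U * Uᵀ).trace)
    (hpos : 0 < (U * Uᵀ).trace) :
    ∃ u v : Matrix (Fin n) (Fin m) ℝ, IsOrthonormalPair metric a u v ∧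
      ∃ r k : ℝ, 0 < k ∧ u * pinv a = r • U ∧ v * pinv a = r • V ∧
        sectionalCurvature metric a u v = k * curvForm m (a * pinv a) U V := by
  have hd : 0 < √(aᵀ * a).det := Real.sqrt_pos.2 (det_gram_pos ha)
  let r : ℝ := (√((U * Uᵀ).trace * √(aᵀ * a).det))⁻¹
  have hr : r ^ 2 * ((U * Uᵀ).trace * √(aᵀ * a).det) = 1 := by
    rw [inv_pow, Real.sq_sqrt (by positivity)]
    exact inv_mul_cancel₀ (by positivity)
  have hr0 : 0 < r := by positivity
  have e {X : Matrix (Fin n) (Fin n) ℝ} (hX : X * (a * pinv a) = X) :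
      (r • (X * a)) * pinv a = r • X := by
    rw [Matrix.smul_mul, Matrix.mul_assoc, hX]
  have e0 {X : Matrix (Fin n) (Fin n) ℝ} (hX : X * (a * pinv a) = X) (h0 : X.trace = 0) :
      squareTracelessPart a (r • (X * a)) = r • X := by
    rw [squareTracelessPart, e hX, Matrix.trace_smul, h0]
    simp
  have ho : IsOrthonormalPair metric a (r • (U * a)) (r • (V * a)) := by
    refine ⟨?_, ?_, ?_⟩ <;>
    simp only [metric_eq ha, e hU, e hV, Matrix.transpose_smul, Matrix.smul_mul, Matrix.mul_smul,
      Matrix.trace_smul, smul_eq_mul, hq, hUV] <;> linarith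
  refine ⟨_, _, ho, r, r ^ 4 * √(aᵀ * a).det / 4, by positivity, e hU, e hV, ?_⟩
  have := metric_riemannCurvature ha (r • (U * a)) (r • (V * a))
  rw [e0 hU hU0, e0 hV hV0, curvForm_smul] at this
  rw [sectionalCurvature_orthonormal ho]
  linarith

theorem vecMul_proj_of_mem_range (ha : IsUnit (aᵀ * a).det) {x : Fin n → ℝ}
    (hx : x ∈ LinearMap.range a.mulVecLin) : x ᵥ* (a * pinv a) = x := by
  obtain ⟨y, rfl⟩ := hx
  rw [← Matrix.mulVec_transpose, proj_transpose, Matrix.mulVecLin_apply, Matrix.mulVec_mulVec,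
    Matrix.mul_assoc, pinv_mul ha, Matrix.mul_one]

theorem proj_mulVec_of_mem_ker {f : Fin n → ℝ} (hf : f ∈ LinearMap.ker aᵀ.mulVecLin) :
    (a * pinv a) *ᵥ f = 0 := by
  rw [LinearMap.mem_ker, Matrix.mulVecLin_apply] at hf
  rw [pinv_eq, ← Matrix.mul_assoc, ← Matrix.mulVec_mulVec, hf, Matrix.mulVec_zero]

/-- For orthonormal `x`, `y` in the range of `a`, the symmetric matrices `x xᵀ - y yᵀ` and
`x yᵀ + y xᵀ` give a horizontal plane of negative curvature. -/
theorem exists_horizontal_neg (ha : IsUnit (aᵀ * a).det) (hr : a.rank = m) (hm : 2 ≤ m) :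
    ∃ u v : Matrix (Fin n) (Fin m) ℝ, IsOrthonormalPair metric a u v ∧
      (u * pinv a).IsSymm ∧ (v * pinv a).IsSymm ∧ sectionalCurvature metric a u v < 0 := by
  obtain ⟨x, hx, y, hy, hxx, hyy, hxy⟩ :=
    exists_orthonormal_pair (LinearMap.range a.mulVecLin) (by rw [← hr] at hm; exact hm)
  have hyx : y ⬝ᵥ x = 0 := by rw [dotProduct_comm, hxy]
  have hxP := vecMul_proj_of_mem_range ha hx
  have hyP := vecMul_proj_of_mem_range ha hy
  set P := a * pinv a with hP
  let U := Matrix.vecMulVec x x - Matrix.vecMulVec y y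
  let V := Matrix.vecMulVec x y + Matrix.vecMulVec y x
  have hUs : U.IsSymm := by simp [Matrix.IsSymm, U, Matrix.transpose_vecMulVec]
  have hVs : V.IsSymm := by simp [Matrix.IsSymm, V, Matrix.transpose_vecMulVec, add_comm]
  have hU : U * P = U := by
    simp [U, Matrix.sub_mul, Matrix.vecMulVec_mul, hxP, hyP]
  have hV : V * P = V := by
    simp [V, Matrix.add_mul, Matrix.vecMulVec_mul, hxP, hyP]
  have hU0 : U.trace = 0 := by simp [U, Matrix.trace_vecMulVec, hxx, hyy]
  have hV0 : V.trace = 0 := by simp [V, Matrix.trace_vecMulVec, hxy, hyx]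
  have hUV : (U * Vᵀ).trace = 0 := by
    rw [hVs.eq]
    simp [U, V, Matrix.sub_mul, Matrix.mul_add, Matrix.vecMulVec_mul_vecMulVec,
      Matrix.trace_vecMulVec, hxx, hyy, hxy, hyx]
  have hUU : (U * Uᵀ).trace = 2 := by
    rw [hUs.eq]
    simp [U, Matrix.sub_mul, Matrix.mul_sub, Matrix.vecMulVec_mul_vecMulVec,
      Matrix.trace_vecMulVec, hxx, hyy, hxy, hyx]
    norm_num
  have hVV : (V * Vᵀ).trace = 2 := by
    rw [hVs.eq]
    simp [V, Matrix.add_mul, Matrix.mul_add, Matrix.vecMulVec_mul_vecMulVec,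
      Matrix.trace_vecMulVec, hxx, hyy, hxy, hyx]
    norm_num
  obtain ⟨u, v, ho, r, k, hk, hu, hv, hK⟩ := exists_orthonormal_of_square ha hU hV hU0 hV0 hUV
    (by rw [hUU, hVV]) (by rw [hUU]; norm_num)
  refine ⟨u, v, ho, by rw [hu]; exact hUs.smul r, by rw [hv]; exact hVs.smul r, ?_⟩
  rw [hK, ← hP, curvForm_of_isSymm _ hU hV hUs hVs, traceGram, hUU, hVV, hUV]
  have h1 := trace_mul_transpose_self_nonneg ⁅U, V⁆
  have h2 : (2 : ℝ) ≤ m := by exact_mod_cast hm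
  exact mul_neg_of_pos_of_neg hk (by linarith)

/-- Two tangent vectors of rank one with a common row space and orthogonal images outside the range
of `a` span a plane whose curvature has the sign of `4 - m`. -/
theorem exists_pos (ha : IsUnit (aᵀ * a).det) (hr : a.rank = m) (hm : 2 ≤ m) (hm' : m < 4)
    (hn : m + 2 ≤ n) :
    ∃ u v : Matrix (Fin n) (Fin m) ℝ, IsOrthonormalPair metric a u v ∧
      0 < sectionalCurvature metric a u v := by
  obtain ⟨x, hx, -, -, hxx, -, -⟩ :=
    exists_orthonormal_pair (LinearMap.range a.mulVecLin) (by rw [← hr] at hm; exact hm)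
  have hker : 2 ≤ Module.finrank ℝ (LinearMap.ker aᵀ.mulVecLin) := by
    have h1 := LinearMap.finrank_range_add_finrank_ker aᵀ.mulVecLin
    have h2 : Module.finrank ℝ (LinearMap.range aᵀ.mulVecLin) = m := by
      exact (Matrix.rank_transpose a).trans hr
    rw [h2, Module.finrank_fin_fun] at h1
    omega
  obtain ⟨f, hf, g, hg, hff, hgg, hfg⟩ := exists_orthonormal_pair _ hker
  have hgf : g ⬝ᵥ f = 0 := by rw [dotProduct_comm, hfg]
  have hxP := vecMul_proj_of_mem_range ha hx
  have hPf := proj_mulVec_of_mem_ker hf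
  have hPg := proj_mulVec_of_mem_ker hg
  set P := a * pinv a with hP
  have hxf : f ⬝ᵥ x = 0 := by
    rw [dotProduct_comm, ← hxP, ← Matrix.dotProduct_mulVec, hPf, dotProduct_zero]
  have hxg : g ⬝ᵥ x = 0 := by
    rw [dotProduct_comm, ← hxP, ← Matrix.dotProduct_mulVec, hPg, dotProduct_zero]
  let U := Matrix.vecMulVec f x
  let V := Matrix.vecMulVec g x
  have hU : U * P = U := by simp [U, Matrix.vecMulVec_mul, hxP]
  have hV : V * P = V := by simp [V, Matrix.vecMulVec_mul, hxP]
  have hPU : P * U = 0 := by simp [U, Matrix.mul_vecMulVec, hPf]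
  have hPV : P * V = 0 := by simp [V, Matrix.mul_vecMulVec, hPg]
  have hU0 : U.trace = 0 := by simp [U, Matrix.trace_vecMulVec, hxf]
  have hV0 : V.trace = 0 := by simp [V, Matrix.trace_vecMulVec, hxg]
  have hUV : (U * Vᵀ).trace = 0 := by
    simp [U, V, Matrix.transpose_vecMulVec, Matrix.vecMulVec_mul_vecMulVec,
      Matrix.trace_vecMulVec, hxx, hfg]
  have hUU : (U * Uᵀ).trace = 1 := by
    simp [U, Matrix.transpose_vecMulVec, Matrix.vecMulVec_mul_vecMulVec,
      Matrix.trace_vecMulVec, hxx, hff]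
  have hVV : (V * Vᵀ).trace = 1 := by
    simp [V, Matrix.transpose_vecMulVec, Matrix.vecMulVec_mul_vecMulVec,
      Matrix.trace_vecMulVec, hxx, hgg]
  have hUtV : Uᵀ * V = 0 := by
    simp [U, V, Matrix.transpose_vecMulVec, Matrix.vecMulVec_mul_vecMulVec, hfg]
  have hUtU : Uᵀ * U = Matrix.vecMulVec x x := by
    simp [U, Matrix.transpose_vecMulVec, Matrix.vecMulVec_mul_vecMulVec, hff]
  have hVtV : Vᵀ * V = Matrix.vecMulVec x x := by
    simp [V, Matrix.transpose_vecMulVec, Matrix.vecMulVec_mul_vecMulVec, hgg]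
  obtain ⟨u, v, ho, r, k, hk, -, -, hK⟩ := exists_orthonormal_of_square ha hU hV hU0 hV0 hUV
    (by rw [hUU, hVV]) (by rw [hUU]; norm_num)
  refine ⟨u, v, ho, ?_⟩
  have h2 : (m : ℝ) < 4 := by exact_mod_cast hm'
  rw [hK, ← hP, curvForm_of_proj_mul_eq_zero _ (proj_transpose a) hU hV hPU hPV, traceGram, hUU,
    hVV, hUV, hUtV, hUtU, hVtV, Matrix.vecMulVec_mul_vecMulVec]
  refine mul_pos hk ?_
  simp [Matrix.trace_vecMulVec, hxx]
  linarith

end existence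

/-! ### Horizontal planes -/

/-- The sign of the curvature form on horizontal vectors, by the Cauchy-Schwarz inequality. -/
theorem curvForm_nonpos_of_isSymm {P U V : Matrix (Fin n) (Fin n) ℝ} {c : ℝ} (hc : 0 < c)
    (hU : U * P = U) (hV : V * P = V) (hUs : U.IsSymm) (hVs : V.IsSymm) :
    curvForm c P U V ≤ 0 ∧ (curvForm c P U V < 0 ↔ LinearIndependent ℝ ![U, V]) := by
  have h1 := trace_mul_transpose_self_nonneg ⁅U, V⁆
  have h2 := mul_nonneg hc.le (traceGram_nonneg U V)
  rw [curvForm_of_isSymm c hU hV hUs hVs]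
  refine ⟨by linarith, fun h => ?_, fun h => ?_⟩
  · by_contra hli
    have hz : ⁅U, V⁆ = 0 := by
      rcases eq_zero_or_eq_smul_of_not_linearIndependent hli with rfl | ⟨r, rfl⟩ <;>
        simp [Ring.lie_def]
    rw [traceGram_eq_zero hli, hz] at h
    simp at h
  · have := mul_pos hc (traceGram_pos h)
    linarith

theorem squareTracelessPart_isSymm {a u : Matrix (Fin n) (Fin m) ℝ} (hu : (u * pinv a).IsSymm) :
    (squareTracelessPart a u).IsSymm := by
  rw [squareTracelessPart]
  exact hu.sub ((show (a * pinv a).IsSymm from proj_transpose a).smul _)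

end FullRank

end

theorem mainTheorem3 (n m : ℕ) (a : Matrix (Fin n) (Fin m) ℝ) (ha : a ∈ FullRank.MPlus n m) :
    -- the formula for the sectional curvature
    (∀ u v : Matrix (Fin n) (Fin m) ℝ, FullRank.IsOrthonormalPair FullRank.metric a u v →
      FullRank.sectionalCurvature FullRank.metric a u v =
        FullRank.metric a (FullRank.riemannCurvature FullRank.metric a u v v) u ∧
      ∀ U₀ V₀ P : Matrix (Fin n) (Fin n) ℝ,
        U₀ = FullRank.squareTracelessPart a u → V₀ = FullRank.squareTracelessPart a v →
        P = a * FullRank.pinv a →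
        4 * FullRank.sectionalCurvature FullRank.metric a u v / √(aᵀ * a).det =
          2 * (⁅V₀, U₀⁆ * ⁅V₀ᵀ, U₀⁆).trace
          + 2 * (⁅V₀, U₀ᵀ⁆ * ⁅V₀, U₀⁆).trace
          + 2 * (V₀ * U₀ * V₀ᵀ * U₀ᵀ).trace
          + (V₀ * V₀ᵀ * U₀ᵀ * U₀).trace
          - 4 * (V₀ * V₀ * U₀ᵀ * U₀ᵀ).trace
          + 4 * (V₀ * U₀ᵀ * U₀ * V₀ᵀ).trace
          + (V₀ᵀ * V₀ * U₀ * U₀ᵀ).trace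
          - 2 * (V₀ * V₀ᵀ * U₀ * U₀ᵀ).trace
          - 2 * (V₀ * U₀ᵀ * V₀ * U₀ᵀ).trace
          + 6 * (V₀ * U₀ᵀ * V₀ * U₀ᵀ * P).trace
          - 3 * (V₀ * U₀ᵀ * U₀ * V₀ᵀ * P).trace
          - 3 * (U₀ * V₀ᵀ * V₀ * U₀ᵀ * P).trace
          - m * (V₀ * V₀ᵀ).trace * (U₀ * U₀ᵀ).trace
          + m * (U₀ * V₀ᵀ).trace ^ 2) ∧
    -- (1) pure trace directions
    (∀ u v : Matrix (Fin n) (Fin m) ℝ, LinearIndependent ℝ ![u, v] →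
      FullRank.IsPureTrace a u ∨ FullRank.IsPureTrace a v →
      FullRank.sectionalCurvature FullRank.metric a u v = 0) ∧
    -- (2) horizontal directions
    (2 ≤ m →
      (∀ u v : Matrix (Fin n) (Fin m) ℝ, LinearIndependent ℝ ![u, v] →
        (u * FullRank.pinv a).IsSymm → (v * FullRank.pinv a).IsSymm →
        FullRank.sectionalCurvature FullRank.metric a u v ≤ 0 ∧
        (FullRank.sectionalCurvature FullRank.metric a u v < 0 ↔
          LinearIndependent ℝ ![FullRank.tracelessPart a u, FullRank.tracelessPart a v])) ∧
      ∃ u v : Matrix (Fin n) (Fin m) ℝ, FullRank.IsOrthonormalPair FullRank.metric a u v ∧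
        (u * FullRank.pinv a).IsSymm ∧ (v * FullRank.pinv a).IsSymm ∧
        FullRank.sectionalCurvature FullRank.metric a u v < 0) ∧
    -- (3) the case of one column
    (m = 1 → ∀ u v : Matrix (Fin n) (Fin m) ℝ, LinearIndependent ℝ ![u, v] →
      0 ≤ FullRank.sectionalCurvature FullRank.metric a u v ∧
      (n = 2 → FullRank.sectionalCurvature FullRank.metric a u v = 0)) ∧
    -- (4) both signs occur at every point
    (m = 2 ∨ m = 3 → m + 2 ≤ n →
      (∃ u v : Matrix (Fin n) (Fin m) ℝ, FullRank.IsOrthonormalPair FullRank.metric a u v ∧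
        0 < FullRank.sectionalCurvature FullRank.metric a u v) ∧
      ∃ u v : Matrix (Fin n) (Fin m) ℝ, FullRank.IsOrthonormalPair FullRank.metric a u v ∧
        FullRank.sectionalCurvature FullRank.metric a u v < 0) := by
  have hg := FullRank.isUnit_det_gram ha
  have hd : 0 < √(aᵀ * a).det := Real.sqrt_pos.2 (FullRank.det_gram_pos hg)
  have hden {u v : Matrix (Fin n) (Fin m) ℝ} (h : LinearIndependent ℝ ![u, v]) :
      0 < 4 * √(aᵀ * a).det *
        FullRank.traceGram (u * FullRank.pinv a) (v * FullRank.pinv a) :=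
    mul_pos (by positivity)
      (FullRank.traceGram_pos ((FullRank.linearIndependent_mul_pinv hg u v).2 h))
  refine ⟨fun u v ho => ?_, fun u v _ hp => ?_, fun hm => ⟨fun u v h hu hv => ?_, ?_⟩,
    fun hm u v h => ?_, fun hm hn => ?_⟩
  · have hK := FullRank.sectionalCurvature_orthonormal ho
    refine ⟨hK, ?_⟩
    rintro _ _ _ rfl rfl rfl
    rw [hK, FullRank.metric_riemannCurvature hg, mul_div_cancel_right₀ _ hd.ne', FullRank.curvForm]
  · rw [FullRank.sectionalCurvature_metric hg]
    rcases hp with hp | hp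
    · rw [FullRank.squareTracelessPart_eq_zero hg hp, FullRank.curvForm_zero_left, zero_div]
    · rw [FullRank.squareTracelessPart_eq_zero hg hp, FullRank.curvForm_zero_right, zero_div]
  · have hm0 : (0 : ℝ) < m := by
      have : 0 < m := by omega
      exact_mod_cast this
    obtain ⟨h1, h2⟩ := FullRank.curvForm_nonpos_of_isSymm hm0
      (FullRank.squareTracelessPart_mul_proj hg u) (FullRank.squareTracelessPart_mul_proj hg v)
      (FullRank.squareTracelessPart_isSymm hu) (FullRank.squareTracelessPart_isSymm hv)
    rw [FullRank.sectionalCurvature_metric hg, ← FullRank.linearIndependent_mul_pinv hg,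
      FullRank.tracelessPart_mul_pinv, FullRank.tracelessPart_mul_pinv, ← h2]
    refine ⟨div_nonpos_of_nonpos_of_nonneg h1 (hden h).le, fun hK => ?_,
      fun hK => div_neg_of_neg_of_pos hK (hden h)⟩
    by_contra h0
    exact absurd hK (not_lt.2 (div_nonneg (not_lt.1 h0) (hden h).le))
  · exact FullRank.exists_horizontal_neg hg ha hm
  · subst hm
    rw [FullRank.sectionalCurvature_metric hg, FullRank.curvForm_one_column hg
      (FullRank.squareTracelessPart_mul_proj hg u) (FullRank.squareTracelessPart_mul_proj hg v)
      (FullRank.trace_squareTracelessPart hg u) (FullRank.trace_squareTracelessPart hg v)]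
    refine ⟨div_nonneg (mul_nonneg (by norm_num) (FullRank.traceGram_nonneg _ _)) (hden h).le, ?_⟩
    rintro rfl
    have hnl := FullRank.not_linearIndependent_tracelessPart hg u v
    rw [← FullRank.linearIndependent_mul_pinv hg, FullRank.tracelessPart_mul_pinv,
      FullRank.tracelessPart_mul_pinv] at hnl
    rw [FullRank.traceGram_eq_zero hnl, mul_zero, zero_div]
  · obtain ⟨u, v, ho, -, -, hK⟩ := FullRank.exists_horizontal_neg hg ha (by omega)
    exact ⟨FullRank.exists_pos hg ha (by omega) (by omega) hn, u, v, ho, hK⟩
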